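/- For $z=(x,\omega)\in\mathbb{R}^2$ and $\phi,f\in L^2(\mathbb{R})$ put $\pi(z)\phi(t)=e^{2\pi i\omega t}\phi(t-x)$ and $\mathcal{V}_\phi f(z)=\langle f,\pi(z)\phi\rangle$, and for $m\in L^1(\mathbb{R}^2)$ let $H_{m,\phi}f=\int_{\mathbb{R}^2}\mathcal{V}_\phi f(z)\,m(z)\,\pi(z)\phi\,dz$ be the time-frequency localization operator with symbol $m$ and window $\phi$. A family of symbols $\eta_\gamma\in L^1(\mathbb{R}^2)$, indexed by points $\gamma$ of the plane, is called well-spread if the index points are relatively separated (the number of them, counted with multiplicity, in a ball of radius $1$ is bounded uniformly in the centre of the ball) and there is a continuous function $g\in L^2(\mathbb{R}^2)$ with polynomial decay $|g(z)|\le C(1+|z|)^{-s}$ for some constants $C$ and $s>2$, such that $|\eta_\gamma(\xi)|\le g(\xi-\gamma)$ for all $\gamma$ and almost every $\xi\in\mathbb{R}^2$. Let $\phi_1,\phi_2\in L^2(\mathbb{R})$ with $\|\phi_1\|_2=\|\phi_2\|_2=1$ and $\|\phi_1-\phi_2\|_2<\frac12$. Let $\Gamma_1,\Gamma_2\subset\mathbb{R}^2$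 and let $\{\eta_{\gamma_1}\mid\gamma_1\in\Gamma_1\}\cup\{\eta_{\gamma_2}\mid\gamma_2\in\Gamma_2\}$ be a well-spread family of non-negative symbols for which there are constants $0<a\le b<\infty$ with $a\le\sum_{i=1}^2\sum_{\gamma_i\in\Gamma_i}\eta_{\gamma_i}(z)\le b$ for almost every $z\in\mathbb{R}^2$. Then there are constants $0<A\le B<\infty$ such that for all $f\in L^2(\mathbb{R})$ $$A\|f\|_2^2\le\sum_{i=1}^2\sum_{\gamma_i\in\Gamma_i}\|H_{\eta_{\gamma_i},\phi_i}f\|_2^2\le B\|f\|_2^2 .$$ -/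

import Mathlib

open MeasureTheory

/-- The function `t ↦ e^{2πiωt} φ(t - x)`, for `z = (x, ω)`, is square integrable. -/
theorem memLp_tfShift (z : ℝ × ℝ) (φ : Lp ℂ 2 (volume : Measure ℝ)) :
    MemLp (fun t : ℝ => Complex.exp (2 * Real.pi * Complex.I * z.2 * t) * φ (t - z.1)) 2
      (volume : Measure ℝ) := by
  have h : MemLp (fun t : ℝ => φ (t - z.1)) 2 (volume : Measure ℝ) :=
    (Lp.memLp φ).comp_measurePreserving (measurePreserving_sub_right volume z.1)
  refine h.congr_norm ?_ (Filter.Eventually.of_forall fun t => ?_)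
  · exact (Continuous.aestronglyMeasurable (by fun_prop)).mul h.1
  · have : 2 * (Real.pi : ℂ) * Complex.I * z.2 * t
        = ((2 * Real.pi * z.2 * t : ℝ) : ℂ) * Complex.I := by push_cast; ring
    rw [norm_mul, this, Complex.norm_exp_ofReal_mul_I, one_mul]

/-- The time-frequency shift `π(x, ω) φ (t) = e^{2πiωt} φ(t - x)` on `L²(ℝ)`. -/
noncomputable def tfShift (z : ℝ × ℝ) (φ : Lp ℂ 2 (volume : Measure ℝ)) :
    Lp ℂ 2 (volume : Measure ℝ) :=
  (memLp_tfShift z φ).toLp _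

/-- The short-time Fourier transform `V_φ f (z) = ⟨f, π(z) φ⟩`. Mathlib's inner product is
conjugate-linear in its first argument, hence the order of the arguments. -/
noncomputable def stft (φ f : Lp ℂ 2 (volume : Measure ℝ)) (z : ℝ × ℝ) : ℂ :=
  inner ℂ (tfShift z φ) f

/-- The time-frequency localization operator
`H_{m,φ} f = ∫ V_φ f(z) m(z) π(z) φ dz`, as a Bochner integral in `L²(ℝ)`. It converges absolutely
for every integrable symbol `m`, since `|V_φ f(z)| ≤ ‖f‖ ‖φ‖` and `‖π(z) φ‖ = ‖φ‖`. -/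
noncomputable def locOp (m : ℝ × ℝ → ℝ) (φ f : Lp ℂ 2 (volume : Measure ℝ)) :
    Lp ℂ 2 (volume : Measure ℝ) :=
  ∫ z : ℝ × ℝ, (stft φ f z * (m z : ℂ)) • tfShift z φ

/-- A family of points of the plane is relatively separated if the number of its members (counted
with multiplicity) in a ball of radius one is bounded uniformly in the centre. In particular each
bounded set contains finitely many of them, so they form a discrete set without accumulation
points. -/
def RelSeparated {ι : Type*} (node : ι → ℝ × ℝ) : Prop :=
  ∃ N : ℕ, ∀ z : ℝ × ℝ, {i | node i ∈ Metric.ball z 1}.encard ≤ N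

/-- A family of integrable symbols `η i` attached to points `node i` of the plane is well-spread if
the points are relatively separated and all symbols, moved to the origin, have a common continuous
envelope `g ∈ L²(ℝ²)` of polynomial decay, with an exponent greater than the dimension `2`. -/
def WellSpread {ι : Type*} (node : ι → ℝ × ℝ) (η : ι → ℝ × ℝ → ℝ) : Prop :=
  RelSeparated node ∧ (∀ i, Integrable (η i)) ∧
    ∃ g : ℝ × ℝ → ℝ, Continuous g ∧ MemLp g 2 ∧
      (∃ C s : ℝ, 2 < s ∧ ∀ z, |g z| ≤ C * (1 + ‖z‖) ^ (-s)) ∧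
      ∀ i, ∀ᵐ ξ : ℝ × ℝ, |η i ξ| ≤ g (ξ - node i)

/-!
Write `V f` for the short-time Fourier transform `V_φ f`, `H_γ` for `H_{η_γ,φ}`, and
`e_u(z) = e^{2πi(u₂z₁ - u₁z₂)}`. By Moyal's identity (`integral_norm_stft_sq`, a consequence of
Plancherel's theorem) `V` is an isometry for a window of norm one, and
`⟨H_γ f, f⟩ = ∫ η_γ |V f|²`.

The upper bound is Cauchy–Schwarz: `‖H_γ f‖² ≤ b ⟨H_γ f, f⟩` (`norm_locOp_sq_le`), and the energies
`⟨H_γ f, f⟩` sum up to at most `b ‖f‖²` for each window.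

For the lower bound, the total energy `∑ᵢ ∑_γ ⟨H_γ f, f⟩` is at least `(a / 4) ‖f‖²`
(`le_total_energy`); this is where the windows have to be close. It remains to bound, for a single
window, the energy by `∑_γ ‖H_γ f‖²` up to a small multiple of `‖f‖²` (`exists_sum_energy_le`). Let
`θ` be the symplectic Fourier transform of a probability density `τ` supported near the origin, and
compare the energy `∑_γ ∫ V(H_γ f) conj(V f)` with the localized form
`Q = ∑_γ ∫ θ(z - γ) V(H_γ f)(z) conj(V f(z)) dz`.

* Since `θ` decays and the points `γ` are relatively separated, `∑_γ |θ(z - γ)|²` is bounded, so `Q`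
  is controlled by `∑_γ ‖H_γ f‖²` and a small multiple of `‖f‖²`.
* `Q` is the average, with density `τ(u)`, of the forms with `e_u(z - γ)` in place of `θ(z - γ)`.
  Modulations of `V` come from time-frequency shifts, `e_u V_φ h = V_{π(u)φ}(π(u)h)`, and
  `π(u) H_γ f` is again an integral of the same kind, with the symbol modulated by `e_u` and the
  window `π(u)φ` for the synthesis. Hence such a form differs from the energy only through
  `‖π(u)φ - φ‖`, which is small by strong continuity of `π`, and through
  `∑_γ |e_u(z - γ) - 1| η_γ(z)`, which is small by the common decay of the symbols
  (`norm_integral_modulated_sub_le`).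

No decay of the windows in phase space is needed.
-/

open scoped FourierTransform ENNReal SchwartzMap ContDiff ComplexConjugate

/-! ### Plancherel's theorem for integrable functions -/

/-- The Fourier integral of a function in `L¹ ∩ L²` is its Fourier transform in `L²`: both agree as
tempered distributions. -/
theorem fourier_ae_eq_fourier_toLp {F : ℝ → ℂ} (h1 : Integrable F) (h2 : MemLp F 2) :
    𝓕 F =ᵐ[volume] (𝓕 (h2.toLp F) : Lp ℂ 2 (volume : Measure ℝ)) := by
  have hc : Continuous (𝓕 F) :=
    VectorFourier.fourierIntegral_continuous Real.continuous_fourierChar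
      (by exact continuous_inner) h1
  refine ae_eq_of_integral_contDiff_smul_eq hc.locallyIntegrable
    ((Lp.memLp _).locallyIntegrable (by norm_num)) fun g g_smooth g_cpt => ?_
  have hg₁ : HasCompactSupport (Complex.ofRealCLM ∘ g) := g_cpt.comp_left rfl
  have hg₂ : ContDiff ℝ ∞ (Complex.ofRealCLM ∘ g) := by fun_prop
  set G : 𝓢(ℝ, ℂ) := hg₁.toSchwartzMap hg₂ with hG
  have hGa : ∀ x, G x = (g x : ℂ) := fun x => rfl
  have key : (𝓕 ((h2.toLp F : Lp ℂ 2 (volume : Measure ℝ)) : 𝓢'(ℝ, ℂ))) G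
      = ((𝓕 (h2.toLp F) : Lp ℂ 2 (volume : Measure ℝ)) : 𝓢'(ℝ, ℂ)) G := by
    rw [Lp.fourier_toTemperedDistribution_eq]
  rw [TemperedDistribution.fourier_apply, Lp.toTemperedDistribution_apply,
    Lp.toTemperedDistribution_apply] at key
  have e1 : ∫ x, g x • (𝓕 (h2.toLp F) : Lp ℂ 2 (volume : Measure ℝ)) x
      = ∫ x, G x • (𝓕 (h2.toLp F) : Lp ℂ 2 (volume : Measure ℝ)) x := by
    simp [hGa]
  have e2 : ∫ x, g x • 𝓕 F x = ∫ x, G x • 𝓕 F x := by simp [hGa]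
  rw [e1, e2, ← key]
  have e3 : ∫ x, (𝓕 G) x • (h2.toLp F) x = ∫ x, (𝓕 G) x • F x :=
    integral_congr_ae (by filter_upwards [h2.coeFn_toLp] with x hx; rw [hx])
  rw [e3, SchwartzMap.fourier_coe]
  have := VectorFourier.integral_fourierIntegral_smul_eq_flip (μ := volume) (ν := volume)
    (f := G) (g := F) (L := innerₗ ℝ) Real.continuous_fourierChar
      (by exact continuous_inner) G.integrable h1
  rw [flip_innerₗ] at this
  exact this.symm

/-- Plancherel's theorem for the Fourier integral on `L¹ ∩ L²`. -/
theorem lintegral_enorm_fourier_sq {F : ℝ → ℂ} (h1 : Integrable F) (h2 : MemLp F 2) :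
    ∫⁻ w, ‖𝓕 F w‖ₑ ^ 2 = ∫⁻ t, ‖F t‖ₑ ^ 2 := by
  have e : eLpNorm (𝓕 F) 2 = eLpNorm F 2 := by
    rw [eLpNorm_congr_ae (fourier_ae_eq_fourier_toLp h1 h2), ← Lp.enorm_def,
      ← eLpNorm_congr_ae h2.coeFn_toLp, ← Lp.enorm_def, ← ofReal_norm, ← ofReal_norm,
      Lp.norm_fourier_eq]
  have h : ∀ G : ℝ → ℂ, ∫⁻ t, ‖G t‖ₑ ^ 2 = eLpNorm G 2 ^ 2 := fun G => by
    rw [eLpNorm_eq_lintegral_rpow_enorm_toReal (p := 2) (by norm_num) (by norm_num),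
      ← ENNReal.rpow_natCast, ← ENNReal.rpow_mul]
    simp
  rw [h, h, e]

/-! ### Time-frequency shifts -/

theorem tfShift_coeFn (z : ℝ × ℝ) (φ : Lp ℂ 2 (volume : Measure ℝ)) :
    tfShift z φ =ᵐ[volume]
      fun t : ℝ => Complex.exp (2 * Real.pi * Complex.I * z.2 * t) * φ (t - z.1) :=
  (memLp_tfShift z φ).coeFn_toLp

theorem norm_exp_two_pi_I (w t : ℝ) : ‖Complex.exp (2 * Real.pi * Complex.I * w * t)‖ = 1 := by
  have : 2 * (Real.pi : ℂ) * Complex.I * w * t = ((2 * Real.pi * w * t : ℝ) : ℂ) * Complex.I := by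
    push_cast; ring
  rw [this, Complex.norm_exp_ofReal_mul_I]

theorem ae_comp_sub {p : ℝ → Prop} (h : ∀ᵐ t : ℝ, p t) (x : ℝ) : ∀ᵐ t : ℝ, p (t - x) :=
  (measurePreserving_sub_right volume x).quasiMeasurePreserving.ae h

theorem norm_tfShift (z : ℝ × ℝ) (φ : Lp ℂ 2 (volume : Measure ℝ)) : ‖tfShift z φ‖ = ‖φ‖ := by
  rw [Lp.norm_def, Lp.norm_def, eLpNorm_congr_ae (tfShift_coeFn z φ)]
  congr 1
  have h := eLpNorm_comp_measurePreserving (p := 2) (Lp.memLp φ).1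
    (measurePreserving_sub_right volume z.1)
  rw [← h]
  refine eLpNorm_congr_norm_ae (Filter.Eventually.of_forall fun t => ?_)
  simp [norm_exp_two_pi_I]

theorem tfShift_add (z : ℝ × ℝ) (φ ψ : Lp ℂ 2 (volume : Measure ℝ)) :
    tfShift z (φ + ψ) = tfShift z φ + tfShift z ψ := by
  ext1
  filter_upwards [tfShift_coeFn z (φ + ψ), tfShift_coeFn z φ, tfShift_coeFn z ψ,
    ae_comp_sub (Lp.coeFn_add φ ψ) z.1, Lp.coeFn_add (tfShift z φ) (tfShift z ψ)]
    with t h1 h2 h3 h4 h5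
  rw [h1, h5, Pi.add_apply, h2, h3, h4, Pi.add_apply, mul_add]

theorem tfShift_smul (z : ℝ × ℝ) (c : ℂ) (φ : Lp ℂ 2 (volume : Measure ℝ)) :
    tfShift z (c • φ) = c • tfShift z φ := by
  ext1
  filter_upwards [tfShift_coeFn z (c • φ), tfShift_coeFn z φ,
    ae_comp_sub (Lp.coeFn_smul c φ) z.1, Lp.coeFn_smul c (tfShift z φ)]
    with t h1 h2 h3 h4
  rw [h1, h4, Pi.smul_apply, h2, h3, Pi.smul_apply, smul_eq_mul, smul_eq_mul]
  ring

/-- The time-frequency shift `π(z)` as a linear isometry of `L²(ℝ)`. -/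
noncomputable def tfShiftₗᵢ (z : ℝ × ℝ) :
    Lp ℂ 2 (volume : Measure ℝ) →ₗᵢ[ℂ] Lp ℂ 2 (volume : Measure ℝ) where
  toFun := tfShift z
  map_add' := tfShift_add z
  map_smul' := tfShift_smul z
  norm_map' := norm_tfShift z

theorem tfShiftₗᵢ_apply (z : ℝ × ℝ) (φ : Lp ℂ 2 (volume : Measure ℝ)) :
    tfShiftₗᵢ z φ = tfShift z φ := rfl

theorem inner_tfShift_tfShift (z : ℝ × ℝ) (φ ψ : Lp ℂ 2 (volume : Measure ℝ)) :
    inner ℂ (tfShift z φ) (tfShift z ψ) = inner ℂ φ ψ :=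
  (tfShiftₗᵢ z).inner_map_map φ ψ

/-- The phase `e^{2πi(u₂z₁ - u₁z₂)}`, the exponential of the symplectic form, by which
time-frequency shifts fail to commute. -/
noncomputable def symplPhase (u z : ℝ × ℝ) : ℂ :=
  Complex.exp ((2 * Real.pi * (u.2 * z.1 - u.1 * z.2) : ℝ) * Complex.I)

theorem norm_symplPhase (u z : ℝ × ℝ) : ‖symplPhase u z‖ = 1 :=
  Complex.norm_exp_ofReal_mul_I _

theorem symplPhase_add (u z w : ℝ × ℝ) :
    symplPhase u (z + w) = symplPhase u z * symplPhase u w := by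
  rw [symplPhase, symplPhase, symplPhase, ← Complex.exp_add]
  congr 1
  simp only [Prod.fst_add, Prod.snd_add]
  push_cast
  ring

theorem symplPhase_zero_left (z : ℝ × ℝ) : symplPhase 0 z = 1 := by
  simp [symplPhase]

theorem conj_symplPhase (u z : ℝ × ℝ) : conj (symplPhase u z) = symplPhase u (-z) := by
  rw [symplPhase, symplPhase, ← Complex.exp_conj]
  congr 1
  simp only [map_mul, Complex.conj_ofReal, Complex.conj_I, Prod.fst_neg, Prod.snd_neg]
  push_cast
  ring

theorem symplPhase_neg_mul_self (u z : ℝ × ℝ) : symplPhase u (-z) * symplPhase u z = 1 := by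
  rw [← symplPhase_add]; simp [symplPhase]

theorem continuous_symplPhase : Continuous fun p : (ℝ × ℝ) × (ℝ × ℝ) => symplPhase p.1 p.2 := by
  unfold symplPhase; fun_prop

/-- The commutation relation `π(u) π(z) = e^{2πi(u₂z₁ - u₁z₂)} π(z) π(u)`. -/
theorem tfShift_comm (u z : ℝ × ℝ) (φ : Lp ℂ 2 (volume : Measure ℝ)) :
    tfShift u (tfShift z φ) = symplPhase u z • tfShift z (tfShift u φ) := by
  ext1
  filter_upwards [tfShift_coeFn u (tfShift z φ), tfShift_coeFn z (tfShift u φ),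
    ae_comp_sub (tfShift_coeFn z φ) u.1, ae_comp_sub (tfShift_coeFn u φ) z.1,
    Lp.coeFn_smul (symplPhase u z) (tfShift z (tfShift u φ))] with t h1 h2 h3 h4 h5
  rw [h1, h5, Pi.smul_apply, h2, h3, h4, smul_eq_mul, symplPhase, ← mul_assoc, ← mul_assoc,
    ← mul_assoc, ← Complex.exp_add, ← Complex.exp_add, ← Complex.exp_add, sub_right_comm]
  congr 2
  push_cast
  ring

theorem tfShift_eq_modulation_translation (z : ℝ × ℝ) (φ : Lp ℂ 2 (volume : Measure ℝ)) :
    tfShift z φ = tfShift (0, z.2) (tfShift (z.1, 0) φ) := by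
  ext1
  filter_upwards [tfShift_coeFn z φ, tfShift_coeFn (0, z.2) (tfShift (z.1, 0) φ),
    ae_comp_sub (tfShift_coeFn (z.1, 0) φ) 0] with t h1 h2 h3
  rw [h1, h2, h3]
  simp

theorem tfShift_zero (φ : Lp ℂ 2 (volume : Measure ℝ)) : tfShift 0 φ = φ := by
  ext1
  filter_upwards [tfShift_coeFn 0 φ] with t h1
  rw [h1]
  simp

theorem continuous_translation (φ : Lp ℂ 2 (volume : Measure ℝ)) :
    Continuous fun x : ℝ => tfShift (x, 0) φ := by
  let g : ℝ → C(ℝ, ℝ) := fun x => ⟨fun t => t - x, by fun_prop⟩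
  have hg : Continuous g :=
    ContinuousMap.continuous_of_continuous_uncurry _ (by simp [g, Function.uncurry_def]; fun_prop)
  have h := (continuous_const (y := φ)).compMeasurePreservingLp hg
    (fun x => measurePreserving_sub_right volume x) (by norm_num)
  convert h using 2 with x
  ext1
  filter_upwards [tfShift_coeFn (x, 0) φ, Lp.coeFn_compMeasurePreserving φ
    (measurePreserving_sub_right volume x)] with t h1 h2
  rw [h1]
  refine Eq.trans ?_ h2.symm
  simp

theorem continuous_modulation (φ : Lp ℂ 2 (volume : Measure ℝ)) :
    Continuous fun w : ℝ => tfShift (0, w) φ := by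
  have hint : Integrable fun t => ‖φ t‖ ^ 2 := (Lp.memLp φ).integrable_norm_pow (by norm_num)
  -- By polarization and isometry it suffices that `⟨M_{w₀} φ, M_w φ⟩` depends continuously on `w`.
  have hin : ∀ w₀ : ℝ, Continuous fun w : ℝ => inner ℂ (tfShift (0, w₀) φ) (tfShift (0, w) φ) := by
    intro w₀
    have : ∀ w : ℝ, inner ℂ (tfShift (0, w₀) φ) (tfShift (0, w) φ) =
        ∫ t : ℝ, Complex.exp (2 * Real.pi * Complex.I * (w - w₀ : ℝ) * t) * (‖φ t‖ ^ 2 : ℝ) := by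
      intro w
      rw [L2.inner_def]
      refine integral_congr_ae ?_
      filter_upwards [tfShift_coeFn (0, w) φ, tfShift_coeFn (0, w₀) φ] with t h1 h2
      rw [h1, h2, RCLike.inner_apply]
      simp only [sub_zero, map_mul, ← Complex.exp_conj, Complex.conj_ofReal, Complex.conj_I,
        map_ofNat]
      have : ((‖φ t‖ ^ 2 : ℝ) : ℂ) = φ t * conj (φ t) := by
        rw [Complex.mul_conj, Complex.normSq_eq_norm_sq]
      rw [this, Complex.ofReal_sub, mul_sub, sub_mul, sub_eq_add_neg, Complex.exp_add]
      ring_nf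
    simp_rw [this]
    refine continuous_of_dominated (bound := fun t => ‖φ t‖ ^ 2) (fun w => ?_) (fun w => ?_) hint ?_
    · exact (Continuous.aestronglyMeasurable (by fun_prop)).mul
        (Complex.continuous_ofReal.comp_aestronglyMeasurable hint.1)
    · refine Filter.Eventually.of_forall fun t => ?_
      rw [norm_mul, norm_exp_two_pi_I, one_mul, Complex.norm_real, Real.norm_of_nonneg (by positivity)]
    · refine Filter.Eventually.of_forall fun t => by fun_prop
  rw [continuous_iff_continuousAt]
  intro w₀
  rw [ContinuousAt, tendsto_iff_norm_sub_tendsto_zero]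
  have h2 : Filter.Tendsto (fun w : ℝ => ‖tfShift (0, w) φ - tfShift (0, w₀) φ‖ ^ 2)
      (nhds w₀) (nhds 0) := by
    have h3 : ∀ w : ℝ, ‖tfShift (0, w) φ - tfShift (0, w₀) φ‖ ^ 2 =
        2 * ‖φ‖ ^ 2 - 2 * RCLike.re (inner ℂ (tfShift (0, w₀) φ) (tfShift (0, w) φ)) := by
      intro w
      rw [norm_sub_rev, norm_sub_sq (𝕜 := ℂ), norm_tfShift, norm_tfShift]
      ring
    have h4 : Continuous fun w : ℝ => 2 * ‖φ‖ ^ 2 -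
        2 * RCLike.re (inner ℂ (tfShift (0, w₀) φ) (tfShift (0, w) φ)) :=
      continuous_const.sub (continuous_const.mul (RCLike.continuous_re.comp (hin w₀)))
    simp_rw [h3]
    convert h4.tendsto w₀ using 2
    rw [← h3, sub_self, norm_zero]; norm_num
  have := h2.sqrt
  simpa using this

/-- Time-frequency shifts are strongly continuous. -/
theorem continuous_tfShift (φ : Lp ℂ 2 (volume : Measure ℝ)) :
    Continuous fun z : ℝ × ℝ => tfShift z φ := by
  rw [continuous_iff_continuousAt]
  intro z₀
  rw [ContinuousAt, tendsto_iff_norm_sub_tendsto_zero]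
  have hb : ∀ z : ℝ × ℝ, ‖tfShift z φ - tfShift z₀ φ‖ ≤
      ‖tfShift (z.1, 0) φ - tfShift (z₀.1, 0) φ‖ +
      ‖tfShift (0, z.2) (tfShift (z₀.1, 0) φ) - tfShift (0, z₀.2) (tfShift (z₀.1, 0) φ)‖ := by
    intro z
    rw [tfShift_eq_modulation_translation z, tfShift_eq_modulation_translation z₀,
      ← norm_tfShift (0, z.2) (tfShift (z.1, 0) φ - tfShift (z₀.1, 0) φ)]
    have : tfShift (0, z.2) (tfShift (z.1, 0) φ - tfShift (z₀.1, 0) φ) =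
      tfShift (0, z.2) (tfShift (z.1, 0) φ) - tfShift (0, z.2) (tfShift (z₀.1, 0) φ) :=
      (tfShiftₗᵢ (0, z.2)).map_sub _ _
    rw [this]
    exact norm_sub_le_norm_sub_add_norm_sub _ _ _
  refine squeeze_zero (fun _ => norm_nonneg _) hb ?_
  have hc : Continuous fun z : ℝ × ℝ => ‖tfShift (z.1, 0) φ - tfShift (z₀.1, 0) φ‖ +
      ‖tfShift (0, z.2) (tfShift (z₀.1, 0) φ) - tfShift (0, z₀.2) (tfShift (z₀.1, 0) φ)‖ :=
    (((continuous_translation φ).comp continuous_fst).sub continuous_const).norm.add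
      (((continuous_modulation _).comp continuous_snd).sub continuous_const).norm
  convert hc.tendsto z₀ using 2
  simp

/-! ### The short-time Fourier transform -/

/-- Modulations of a short-time Fourier transform come from time-frequency shifts of both the
window and the function. -/
theorem stft_tfShift_tfShift (u z : ℝ × ℝ) (φ f : Lp ℂ 2 (volume : Measure ℝ)) :
    stft (tfShift u φ) (tfShift u f) z = symplPhase u z * stft φ f z := by
  have h : tfShift z (tfShift u φ) = symplPhase u (-z) • tfShift u (tfShift z φ) := by
    rw [tfShift_comm u z, smul_smul, symplPhase_neg_mul_self, one_smul]
  rw [stft, stft, h, inner_smul_left, inner_tfShift_tfShift, conj_symplPhase, neg_neg]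

theorem stft_add (φ f g : Lp ℂ 2 (volume : Measure ℝ)) (z : ℝ × ℝ) :
    stft φ (f + g) z = stft φ f z + stft φ g z := inner_add_right _ _ _

theorem stft_smul (φ f : Lp ℂ 2 (volume : Measure ℝ)) (c : ℂ) (z : ℝ × ℝ) :
    stft φ (c • f) z = c * stft φ f z := inner_smul_right _ _ _

theorem stft_sum {ι : Type*} (Λ : Finset ι) (φ : Lp ℂ 2 (volume : Measure ℝ))
    (f : ι → Lp ℂ 2 (volume : Measure ℝ)) (z : ℝ × ℝ) :
    stft φ (∑ i ∈ Λ, f i) z = ∑ i ∈ Λ, stft φ (f i) z := inner_sum _ _ _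

theorem stft_sub_left (φ ψ f : Lp ℂ 2 (volume : Measure ℝ)) (z : ℝ × ℝ) :
    stft (φ - ψ) f z = stft φ f z - stft ψ f z := by
  have : tfShift z (φ - ψ) = tfShift z φ - tfShift z ψ := (tfShiftₗᵢ z).map_sub _ _
  rw [stft, this, inner_sub_left, stft, stft]

theorem continuous_stft (φ f : Lp ℂ 2 (volume : Measure ℝ)) : Continuous (stft φ f) :=
  (continuous_tfShift φ).inner continuous_const

theorem norm_stft_le (φ f : Lp ℂ 2 (volume : Measure ℝ)) (z : ℝ × ℝ) :
    ‖stft φ f z‖ ≤ ‖φ‖ * ‖f‖ := by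
  rw [← norm_tfShift z φ]
  exact norm_inner_le_norm _ _

/-- The short-time Fourier transform is the Fourier transform of the windowed function. -/
theorem stft_eq_fourier (φ f : Lp ℂ 2 (volume : Measure ℝ)) (x w : ℝ) :
    stft φ f (x, w) = 𝓕 (fun t => conj (φ (t - x)) * f t) w := by
  rw [stft, L2.inner_def, Real.fourier_real_eq_integral_exp_smul]
  refine integral_congr_ae ?_
  filter_upwards [tfShift_coeFn (x, w) φ] with t h1
  rw [h1, RCLike.inner_apply, map_mul, ← Complex.exp_conj, smul_eq_mul]
  simp only [map_mul, Complex.conj_ofReal, Complex.conj_I, map_ofNat]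
  rw [mul_comm (f t), mul_assoc]
  congr 2
  push_cast
  ring

theorem lintegral_enorm_sq_eq (f : Lp ℂ 2 (volume : Measure ℝ)) :
    ∫⁻ t, ‖f t‖ₑ ^ 2 = ENNReal.ofReal (‖f‖ ^ 2) := by
  rw [ENNReal.ofReal_pow (norm_nonneg _), ofReal_norm, Lp.enorm_def,
    eLpNorm_eq_lintegral_rpow_enorm_toReal (p := 2) (by norm_num) (by norm_num),
    ← ENNReal.rpow_natCast, ← ENNReal.rpow_mul]
  simp

theorem lintegral_enorm_stft_sq (φ f : Lp ℂ 2 (volume : Measure ℝ)) :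
    ∫⁻ z, ‖stft φ f z‖ₑ ^ 2 = ENNReal.ofReal ((‖φ‖ * ‖f‖) ^ 2) := by
  have hmφ : Measurable (φ : ℝ → ℂ) := (Lp.stronglyMeasurable φ).measurable
  have hmf : Measurable (f : ℝ → ℂ) := (Lp.stronglyMeasurable f).measurable
  have hm : Measurable fun p : ℝ × ℝ => ‖conj (φ (p.2 - p.1)) * f p.2‖ₑ ^ 2 := by
    have := Complex.continuous_conj.measurable
    fun_prop
  have hprod : ∫⁻ x : ℝ, ∫⁻ t : ℝ, ‖conj (φ (t - x)) * f t‖ₑ ^ 2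
      = ENNReal.ofReal ((‖φ‖ * ‖f‖) ^ 2) := by
    rw [lintegral_lintegral_swap hm.aemeasurable]
    have h1 : ∀ t : ℝ, ∫⁻ x : ℝ, ‖conj (φ (t - x)) * f t‖ₑ ^ 2
        = ENNReal.ofReal (‖φ‖ ^ 2) * ‖f t‖ₑ ^ 2 := by
      intro t
      simp_rw [enorm_mul, RCLike.enorm_conj, mul_pow]
      rw [lintegral_mul_const _ (by fun_prop), lintegral_sub_left_eq_self (fun s => ‖φ s‖ₑ ^ 2) t,
        lintegral_enorm_sq_eq]
    simp_rw [h1]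
    rw [lintegral_const_mul _ (by fun_prop), lintegral_enorm_sq_eq,
      ← ENNReal.ofReal_mul (by positivity), mul_pow]
  rw [Measure.volume_eq_prod, lintegral_prod _ (by
    exact ((continuous_stft φ f).measurable.enorm.pow_const 2).aemeasurable), ← hprod]
  refine lintegral_congr_ae ?_
  have hfin : ∀ᵐ x : ℝ, ∫⁻ t : ℝ, ‖conj (φ (t - x)) * f t‖ₑ ^ 2 < ⊤ :=
    ae_lt_top hm.lintegral_prod_right' (by rw [hprod]; exact ENNReal.ofReal_ne_top)
  filter_upwards [hfin] with x hx
  have hsh : MemLp (fun t => conj (φ (t - x))) 2 :=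
    ((Lp.memLp φ).comp_measurePreserving (measurePreserving_sub_right volume x)).star
  have h1 : Integrable fun t => conj (φ (t - x)) * f t := hsh.integrable_mul (Lp.memLp f)
  have h2 : MemLp (fun t => conj (φ (t - x)) * f t) 2 := by
    refine ⟨h1.1, ?_⟩
    rw [eLpNorm_lt_top_iff_lintegral_rpow_enorm_lt_top (by norm_num) (by norm_num)]
    simpa using hx
  simp_rw [stft_eq_fourier]
  exact lintegral_enorm_fourier_sq h1 h2

theorem memLp_stft (φ f : Lp ℂ 2 (volume : Measure ℝ)) : MemLp (stft φ f) 2 := by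
  refine ⟨(continuous_stft φ f).aestronglyMeasurable, ?_⟩
  rw [eLpNorm_lt_top_iff_lintegral_rpow_enorm_lt_top (by norm_num) (by norm_num)]
  have := lintegral_enorm_stft_sq φ f
  simpa using this.trans_lt ENNReal.ofReal_lt_top

theorem integrable_norm_stft_sq (φ f : Lp ℂ 2 (volume : Measure ℝ)) :
    Integrable fun z => ‖stft φ f z‖ ^ 2 := (memLp_stft φ f).integrable_norm_pow (by norm_num)

/-- Moyal's identity `‖V_φ f‖ = ‖φ‖ ‖f‖`. -/
theorem integral_norm_stft_sq (φ f : Lp ℂ 2 (volume : Measure ℝ)) :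
    ∫ z, ‖stft φ f z‖ ^ 2 = (‖φ‖ * ‖f‖) ^ 2 := by
  have hm : AEStronglyMeasurable fun z => ‖stft φ f z‖ ^ 2 :=
    ((continuous_stft φ f).norm.pow 2).aestronglyMeasurable
  rw [integral_eq_lintegral_of_nonneg_ae (Filter.Eventually.of_forall fun _ => by positivity) hm,
    ← ENNReal.toReal_ofReal (sq_nonneg (‖φ‖ * ‖f‖)), ← lintegral_enorm_stft_sq]
  simp_rw [ENNReal.ofReal_pow (norm_nonneg _), ofReal_norm]

theorem norm_toLp_stft (φ f : Lp ℂ 2 (volume : Measure ℝ)) :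
    ‖(memLp_stft φ f).toLp (stft φ f)‖ = ‖φ‖ * ‖f‖ := by
  rw [Lp.norm_toLp, eLpNorm_eq_lintegral_rpow_enorm_toReal (p := 2) (by norm_num) (by norm_num)]
  have := lintegral_enorm_stft_sq φ f
  simp only [ENNReal.toReal_ofNat, ENNReal.rpow_ofNat, one_div]
  rw [this, ← ENNReal.toReal_rpow, ENNReal.toReal_ofReal (by positivity), ← one_div,
    ← Real.sqrt_eq_rpow, Real.sqrt_sq (by positivity)]

/-- The short-time Fourier transform with a window of norm one, as a linear isometry. -/
noncomputable def stftₗᵢ (φ : Lp ℂ 2 (volume : Measure ℝ)) (hφ : ‖φ‖ = 1) :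
    Lp ℂ 2 (volume : Measure ℝ) →ₗᵢ[ℂ] Lp ℂ 2 (volume : Measure (ℝ × ℝ)) where
  toFun f := (memLp_stft φ f).toLp (stft φ f)
  map_add' f g := by
    rw [← MemLp.toLp_add]
    exact MemLp.toLp_congr _ _ (Filter.Eventually.of_forall fun z => stft_add φ f g z)
  map_smul' c f := by
    rw [RingHom.id_apply, ← MemLp.toLp_const_smul]
    exact MemLp.toLp_congr _ _ (Filter.Eventually.of_forall fun z => stft_smul φ f c z)
  norm_map' f := by
    change ‖(memLp_stft φ f).toLp (stft φ f)‖ = ‖f‖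
    rw [norm_toLp_stft, hφ, one_mul]

theorem integral_stft_mul_conj_stft {φ : Lp ℂ 2 (volume : Measure ℝ)} (hφ : ‖φ‖ = 1)
    (f g : Lp ℂ 2 (volume : Measure ℝ)) :
    ∫ z, stft φ f z * conj (stft φ g z) = inner ℂ g f := by
  rw [← (stftₗᵢ φ hφ).inner_map_map g f, L2.inner_def]
  refine integral_congr_ae ?_
  filter_upwards [(memLp_stft φ f).coeFn_toLp, (memLp_stft φ g).coeFn_toLp] with z h1 h2
  change _ = inner ℂ ((memLp_stft φ g).toLp (stft φ g) z) ((memLp_stft φ f).toLp (stft φ f) z)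
  rw [h1, h2, RCLike.inner_apply]

/-! ### Relatively separated families of points -/

theorem RelSeparated.countable {ι : Type*} {node : ι → ℝ × ℝ} (h : RelSeparated node) :
    Countable ι := by
  obtain ⟨N, hN⟩ := h
  obtain ⟨s, hs, hd⟩ := TopologicalSpace.exists_countable_dense (ℝ × ℝ)
  have hcov : (Set.univ : Set ι) ⊆ ⋃ z ∈ s, {i | node i ∈ Metric.ball z 1} := by
    intro i _
    obtain ⟨z, hz, hzs⟩ := hd.exists_mem_open Metric.isOpen_ball
      ⟨node i, Metric.mem_ball_self (x := node i) one_pos⟩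
    simp only [Set.mem_iUnion]
    exact ⟨z, hz, Metric.mem_ball_comm.1 hzs⟩
  refine Set.countable_univ_iff.mp (Set.Countable.mono hcov (hs.biUnion fun z _ => ?_))
  exact (Set.finite_of_encard_le_coe (hN z)).countable

theorem RelSeparated.comp_injective {ι κ : Type*} {node : ι → ℝ × ℝ} (h : RelSeparated node)
    {e : κ → ι} (he : Function.Injective e) : RelSeparated (node ∘ e) := by
  obtain ⟨N, hN⟩ := h
  refine ⟨N, fun z => le_trans ?_ (hN z)⟩
  have : e '' {k | (node ∘ e) k ∈ Metric.ball z 1} ⊆ {i | node i ∈ Metric.ball z 1} := by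
    rintro _ ⟨k, hk, rfl⟩; exact hk
  rw [← he.encard_image]
  exact Set.encard_le_encard this

/-- Sums of a function of polynomial decay over a relatively separated family are bounded uniformly
in the centre: each summand is comparable with its average over a unit ball, and these balls
overlap boundedly often, so that the sum is dominated by an integral over the plane. -/
theorem RelSeparated.exists_sum_le {ι : Type*} {node : ι → ℝ × ℝ} (h : RelSeparated node)
    {s : ℝ} (hs : 2 < s) :
    ∃ K : ℝ, 0 < K ∧ ∀ (Λ : Finset ι) (z : ℝ × ℝ),
      ∑ i ∈ Λ, (1 + ‖z - node i‖) ^ (-s) ≤ K := by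
  obtain ⟨N, hN⟩ := h
  have hint : Integrable fun y : ℝ × ℝ => (1 + ‖y‖) ^ (-s) :=
    integrable_one_add_norm (by simpa using hs)
  set I := ∫ y : ℝ × ℝ, (1 + ‖y‖) ^ (-s) with hI
  have hI0 : 0 ≤ I := integral_nonneg fun y => by positivity
  set v := volume.real (Metric.ball (0 : ℝ × ℝ) 1) with hv
  have hv0 : 0 < v := ENNReal.toReal_pos (Metric.measure_ball_pos _ _ one_pos).ne'
    Metric.isBounded_ball.measure_lt_top.ne
  refine ⟨2 ^ s * N / v * I + 1, by positivity, fun Λ z => ?_⟩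
  have hintz : Integrable fun y : ℝ × ℝ => (1 + ‖z - y‖) ^ (-s) := hint.comp_sub_left z
  have hIz : ∫ y : ℝ × ℝ, (1 + ‖z - y‖) ^ (-s) = I :=
    integral_sub_left_eq_self (fun y : ℝ × ℝ => (1 + ‖y‖) ^ (-s)) volume z
  have hvol : ∀ x : ℝ × ℝ, volume.real (Metric.ball x 1) = v := fun x => by
    simp only [hv, Measure.real, Measure.addHaar_ball_center volume x]
  have h1 : ∀ i, v * (1 + ‖z - node i‖) ^ (-s) ≤
      2 ^ s * ∫ y, (Metric.ball (node i) 1).indicator (fun y => (1 + ‖z - y‖) ^ (-s)) y := by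
    intro i
    rw [← hvol (node i), ← integral_const_mul, ← smul_eq_mul,
      ← integral_indicator_const _ Metric.isOpen_ball.measurableSet]
    refine integral_mono ((integrable_indicator_iff Metric.isOpen_ball.measurableSet).2
      (integrableOn_const (by exact Metric.isBounded_ball.measure_lt_top.ne)))
      ((hintz.indicator Metric.isOpen_ball.measurableSet).const_mul _) fun y => ?_
    by_cases hy : y ∈ Metric.ball (node i) 1
    · simp only [Set.indicator_of_mem hy]
      have hy' : ‖node i - y‖ < 1 := by rwa [Metric.mem_ball, dist_comm, dist_eq_norm] at hy
      have hle : 1 + ‖z - y‖ ≤ 2 * (1 + ‖z - node i‖) := by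
        have := norm_sub_le_norm_sub_add_norm_sub z (node i) y
        have := norm_nonneg (z - node i)
        linarith
      have h3 : (2 * (1 + ‖z - node i‖)) ^ (-s) ≤ (1 + ‖z - y‖) ^ (-s) :=
        Real.rpow_le_rpow_of_nonpos (by positivity) hle (by linarith)
      rw [Real.mul_rpow (by norm_num) (by positivity)] at h3
      calc (1 + ‖z - node i‖) ^ (-s)
          = 2 ^ s * (2 ^ (-s) * (1 + ‖z - node i‖) ^ (-s)) := by
            rw [← mul_assoc, ← Real.rpow_add (by norm_num)]; simp
        _ ≤ _ := by gcongr
    · simp [Set.indicator_of_notMem hy]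
  have h2 : ∀ y, ∑ i ∈ Λ, (Metric.ball (node i) 1).indicator (fun y => (1 + ‖z - y‖) ^ (-s)) y
      ≤ N * (1 + ‖z - y‖) ^ (-s) := by
    intro y
    classical
    simp only [Set.indicator_apply]
    rw [← Finset.sum_filter, Finset.sum_const, nsmul_eq_mul]
    gcongr
    have hsub : ((Λ.filter fun i => y ∈ Metric.ball (node i) 1 : Finset ι) : Set ι) ⊆
        {i | node i ∈ Metric.ball y 1} := by
      intro i hi
      have := (Finset.mem_filter.1 hi).2
      rwa [Metric.mem_ball_comm] at this
    have := (Set.encard_le_encard hsub).trans (hN y)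
    rw [Set.encard_coe_eq_coe_finsetCard] at this
    exact_mod_cast this
  have h3 : v * ∑ i ∈ Λ, (1 + ‖z - node i‖) ^ (-s) ≤ 2 ^ s * (N * I) := by
    calc v * ∑ i ∈ Λ, (1 + ‖z - node i‖) ^ (-s)
        ≤ ∑ i ∈ Λ, 2 ^ s *
          ∫ y, (Metric.ball (node i) 1).indicator (fun y => (1 + ‖z - y‖) ^ (-s)) y := by
          rw [Finset.mul_sum]; exact Finset.sum_le_sum fun i _ => h1 i
      _ = 2 ^ s * ∫ y, ∑ i ∈ Λ,
          (Metric.ball (node i) 1).indicator (fun y => (1 + ‖z - y‖) ^ (-s)) y := by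
          rw [integral_finsetSum _ fun i _ => hintz.indicator Metric.isOpen_ball.measurableSet,
            Finset.mul_sum]
      _ ≤ 2 ^ s * ∫ y, N * (1 + ‖z - y‖) ^ (-s) := by
          gcongr
          · exact integrable_finsetSum _ fun i _ =>
              hintz.indicator Metric.isOpen_ball.measurableSet
          · exact hintz.const_mul _
          · exact h2
      _ = 2 ^ s * (N * I) := by rw [integral_const_mul, hIz]
  have : ∑ i ∈ Λ, (1 + ‖z - node i‖) ^ (-s) ≤ 2 ^ s * N / v * I := by
    rw [div_mul_eq_mul_div, le_div_iff₀ hv0]; linarith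
  linarith

/-! ### A kernel concentrated at the origin -/

/-- Interpolation between the bounds `2` and `4π ‖u‖ ‖z‖`. -/
theorem norm_symplPhase_sub_one_le (u z : ℝ × ℝ) {t : ℝ} (ht : 0 < t) (ht1 : t ≤ 1) :
    ‖symplPhase u z - 1‖ ≤ 2 * (4 * Real.pi * ‖u‖ * ‖z‖) ^ t := by
  set y := 4 * Real.pi * ‖u‖ * ‖z‖ with hy
  have hy0 : 0 ≤ y := by positivity
  have h1 : ‖symplPhase u z - 1‖ ≤ y := by
    rw [symplPhase, mul_comm]
    refine (Real.norm_exp_I_mul_ofReal_sub_one_le).trans ?_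
    rw [Real.norm_eq_abs, abs_mul, abs_of_pos (by positivity : (0 : ℝ) < 2 * Real.pi)]
    have a1 : |u.2 * z.1| ≤ ‖u‖ * ‖z‖ := by
      rw [abs_mul]
      exact mul_le_mul (norm_snd_le u) (norm_fst_le z) (abs_nonneg _) (norm_nonneg _)
    have a2 : |u.1 * z.2| ≤ ‖u‖ * ‖z‖ := by
      rw [abs_mul]
      exact mul_le_mul (norm_fst_le u) (norm_snd_le z) (abs_nonneg _) (norm_nonneg _)
    have a3 : |u.2 * z.1 - u.1 * z.2| ≤ 2 * (‖u‖ * ‖z‖) := by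
      have := abs_sub (u.2 * z.1) (u.1 * z.2)
      linarith
    have := mul_le_mul_of_nonneg_left a3 (by positivity : (0 : ℝ) ≤ 2 * Real.pi)
    rw [hy]; linarith
  rcases le_total y 1 with h | h
  · have : y ≤ y ^ t := by
      rcases hy0.eq_or_lt with h0 | h0
      · rw [← h0, Real.zero_rpow ht.ne']
      · simpa using Real.rpow_le_rpow_of_exponent_ge h0 h ht1
    have : 0 ≤ y ^ t := by positivity
    linarith
  · have h2 : ‖symplPhase u z - 1‖ ≤ 2 := by
      have := norm_sub_le (symplPhase u z) 1
      rw [norm_symplPhase, norm_one] at this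
      linarith
    have := Real.one_le_rpow h ht.le
    linarith

/-- There are probability densities `τ` on the plane, supported in arbitrarily small balls, whose
symplectic Fourier transform decays like `(1 + ‖z‖)⁻²`. -/
theorem exists_concentrated_kernel {δ : ℝ} (hδ : 0 < δ) :
    ∃ τ : ℝ × ℝ → ℝ, (∀ u, 0 ≤ τ u) ∧ Integrable τ ∧ ∫ u, τ u = 1 ∧
      (∀ u, τ u ≠ 0 → ‖u‖ < δ) ∧
      ∃ C : ℝ, ∀ z, ‖∫ u, (τ u : ℂ) * symplPhase u z‖ ≤ C * (1 + ‖z‖) ^ (-2 : ℝ) := by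
  let β : ContDiffBump (0 : ℝ) := ⟨δ / 2, δ, by positivity, by linarith⟩
  set g : ℝ → ℝ := β.normed volume with hg
  have hgint : Integrable g := β.integrable_normed
  have hg₁ : HasCompactSupport (Complex.ofRealCLM ∘ g) :=
    (β.hasCompactSupport_normed (μ := volume)).comp_left rfl
  have hg₂ : ContDiff ℝ ∞ (Complex.ofRealCLM ∘ g) :=
    Complex.ofRealCLM.contDiff.comp β.contDiff_normed
  set G : 𝓢(ℝ, ℂ) := hg₁.toSchwartzMap hg₂ with hG
  obtain ⟨C, hC⟩ : ∃ C : ℝ, ∀ w : ℝ, (1 + ‖w‖) ^ 2 * ‖(𝓕 G) w‖ ≤ C := by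
    have h := SchwartzMap.one_add_le_sup_seminorm_apply (𝕜 := ℂ) (m := (2, 0)) (k := 2) (n := 0)
      le_rfl le_rfl (𝓕 G)
    simp only [norm_iteratedFDeriv_zero] at h
    exact ⟨_, h⟩
  refine ⟨fun u => g u.1 * g u.2, fun u => mul_nonneg (β.nonneg_normed _) (β.nonneg_normed _),
    hgint.mul_prod hgint, ?_, ?_, C ^ 2, ?_⟩
  · rw [Measure.volume_eq_prod, integral_prod_mul, hg, β.integral_normed, one_mul]
  · intro u hu
    have h1 : u.1 ∈ Function.support g := fun h => hu (by simp [h])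
    have h2 : u.2 ∈ Function.support g := fun h => hu (by simp [h])
    rw [hg, β.support_normed_eq, mem_ball_zero_iff] at h1 h2
    exact max_lt h1 h2
  · intro z
    have hF : ∀ w : ℝ, ∫ v : ℝ, (g v : ℂ) * Complex.exp ((-2 * Real.pi * v * w : ℝ) * Complex.I)
        = (𝓕 G) w := by
      intro w
      rw [SchwartzMap.fourier_coe, Real.fourier_real_eq_integral_exp_smul]
      refine integral_congr_ae (Filter.Eventually.of_forall fun v => ?_)
      simp only [smul_eq_mul]
      rw [mul_comm]
      rfl
    have hprod : ∫ u : ℝ × ℝ, ((g u.1 * g u.2 : ℝ) : ℂ) * symplPhase u z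
        = (𝓕 G) z.2 * (𝓕 G) (-z.1) := by
      rw [← hF, ← hF, ← integral_prod_mul, Measure.volume_eq_prod]
      refine integral_congr_ae (Filter.Eventually.of_forall fun u => ?_)
      have : symplPhase u z = Complex.exp ((-2 * Real.pi * u.1 * z.2 : ℝ) * Complex.I) *
          Complex.exp ((-2 * Real.pi * u.2 * (-z.1) : ℝ) * Complex.I) := by
        rw [symplPhase, ← Complex.exp_add]
        congr 1
        push_cast
        ring
      simp only [this]
      push_cast
      ring
    rw [hprod, norm_mul]
    have h1 := hC z.2
    have h2 := hC (-z.1)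
    rw [norm_neg] at h2
    have hC0 : 0 ≤ C := le_trans (by positivity) h1
    have h3 : (1 + ‖z‖) ^ 2 ≤ (1 + ‖z.2‖) ^ 2 * (1 + ‖z.1‖) ^ 2 := by
      rw [← mul_pow]
      gcongr
      rw [Prod.norm_def]
      rcases max_cases ‖z.1‖ ‖z.2‖ with ⟨h, _⟩ | ⟨h, _⟩ <;> rw [h] <;>
        nlinarith [norm_nonneg z.1, norm_nonneg z.2, mul_nonneg (norm_nonneg z.1) (norm_nonneg z.2)]
    rw [Real.rpow_neg (by positivity), ← div_eq_mul_inv, le_div_iff₀ (by positivity),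
      Real.rpow_ofNat]
    calc ‖(𝓕 G) z.2‖ * ‖(𝓕 G) (-z.1)‖ * (1 + ‖z‖) ^ 2
        ≤ ‖(𝓕 G) z.2‖ * ‖(𝓕 G) (-z.1)‖ * ((1 + ‖z.2‖) ^ 2 * (1 + ‖z.1‖) ^ 2) := by gcongr
      _ = ((1 + ‖z.2‖) ^ 2 * ‖(𝓕 G) z.2‖) * ((1 + ‖z.1‖) ^ 2 * ‖(𝓕 G) (-z.1)‖) := by ring
      _ ≤ C * C := by gcongr
      _ = C ^ 2 := by ring

/-! ### Localization operators -/

theorem integrable_norm_stft_mul_norm_stft (φ ψ f g : Lp ℂ 2 (volume : Measure ℝ)) :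
    Integrable fun z => ‖stft φ f z‖ * ‖stft ψ g z‖ :=
  (memLp_stft φ f).norm.integrable_mul (memLp_stft ψ g).norm

theorem integral_norm_stft_mul_norm_stft_le (φ ψ f g : Lp ℂ 2 (volume : Measure ℝ)) :
    ∫ z, ‖stft φ f z‖ * ‖stft ψ g z‖ ≤ (‖φ‖ * ‖f‖) * (‖ψ‖ * ‖g‖) := by
  have h := integral_mul_norm_le_Lp_mul_Lq (μ := (volume : Measure (ℝ × ℝ))) (p := 2) (q := 2)
    (f := stft φ f) (g := stft ψ g) Real.HolderConjugate.two_two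
    (by simpa using memLp_stft φ f) (by simpa using memLp_stft ψ g)
  simp only [Real.rpow_ofNat] at h
  rwa [integral_norm_stft_sq, integral_norm_stft_sq, ← Real.sqrt_eq_rpow, ← Real.sqrt_eq_rpow,
    Real.sqrt_sq (by positivity), Real.sqrt_sq (by positivity)] at h

theorem norm_mul_stft_mul_conj_stft (M : ℂ) (φ ψ f g : Lp ℂ 2 (volume : Measure ℝ)) (z : ℝ × ℝ) :
    ‖M * (stft φ f z * conj (stft ψ g z))‖ = ‖M‖ * (‖stft φ f z‖ * ‖stft ψ g z‖) := by
  rw [norm_mul, norm_mul, RCLike.norm_conj]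

theorem integrable_mul_stft_mul_conj_stft {M : ℝ × ℝ → ℂ} (hM : AEStronglyMeasurable M) {b : ℝ}
    (hb : ∀ᵐ z, ‖M z‖ ≤ b) (φ ψ f g : Lp ℂ 2 (volume : Measure ℝ)) :
    Integrable fun z => M z * (stft φ f z * conj (stft ψ g z)) := by
  refine ((integrable_norm_stft_mul_norm_stft φ ψ f g).const_mul b).mono' ?_ ?_
  · exact hM.mul ((continuous_stft φ f).mul
      (Complex.continuous_conj.comp (continuous_stft ψ g))).aestronglyMeasurable
  · filter_upwards [hb] with z hz
    rw [norm_mul_stft_mul_conj_stft]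
    gcongr

/-- A bounded multiplier between two short-time Fourier transforms defines a bounded form. -/
theorem norm_integral_mul_stft_mul_conj_stft_le {M : ℝ × ℝ → ℂ} {b : ℝ} (hb0 : 0 ≤ b)
    (hb : ∀ᵐ z, ‖M z‖ ≤ b) (φ ψ f g : Lp ℂ 2 (volume : Measure ℝ)) :
    ‖∫ z, M z * (stft φ f z * conj (stft ψ g z))‖ ≤ b * ((‖φ‖ * ‖f‖) * (‖ψ‖ * ‖g‖)) := by
  calc ‖∫ z, M z * (stft φ f z * conj (stft ψ g z))‖
      ≤ ∫ z, b * (‖stft φ f z‖ * ‖stft ψ g z‖) := by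
        refine norm_integral_le_of_norm_le
          ((integrable_norm_stft_mul_norm_stft φ ψ f g).const_mul b) ?_
        filter_upwards [hb] with z hz
        rw [norm_mul_stft_mul_conj_stft]
        gcongr
    _ ≤ _ := by
        rw [integral_const_mul]
        gcongr
        exact integral_norm_stft_mul_norm_stft_le φ ψ f g

theorem integrable_symbol_mul_stft {m : ℝ × ℝ → ℝ} (hm : Integrable m)
    (φ ψ f g : Lp ℂ 2 (volume : Measure ℝ)) :
    Integrable fun z => (m z : ℂ) * (stft φ f z * conj (stft ψ g z)) := by
  refine (hm.norm.mul_const ((‖φ‖ * ‖f‖) * (‖ψ‖ * ‖g‖))).mono' ?_ ?_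
  · exact (Complex.continuous_ofReal.comp_aestronglyMeasurable hm.1).mul ((continuous_stft φ f).mul
      (Complex.continuous_conj.comp (continuous_stft ψ g))).aestronglyMeasurable
  · refine Filter.Eventually.of_forall fun z => ?_
    rw [norm_mul_stft_mul_conj_stft, Complex.norm_real]
    gcongr
    · exact norm_stft_le φ f z
    · exact norm_stft_le ψ g z

theorem integrable_symbol_mul_norm_stft_sq {m : ℝ × ℝ → ℝ} (hm : Integrable m)
    (φ f : Lp ℂ 2 (volume : Measure ℝ)) : Integrable fun z => m z * ‖stft φ f z‖ ^ 2 := by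
  refine (hm.norm.mul_const ((‖φ‖ * ‖f‖) ^ 2)).mono'
    (hm.1.mul ((continuous_stft φ f).norm.pow 2).aestronglyMeasurable) ?_
  refine Filter.Eventually.of_forall fun z => ?_
  rw [norm_mul, norm_pow, norm_norm]
  gcongr
  exact norm_stft_le φ f z

theorem integrable_locOp {m : ℝ × ℝ → ℝ} (hm : Integrable m)
    (φ f : Lp ℂ 2 (volume : Measure ℝ)) :
    Integrable fun z => (stft φ f z * (m z : ℂ)) • tfShift z φ := by
  refine (hm.norm.const_mul (‖φ‖ * ‖f‖ * ‖φ‖)).mono' ?_ ?_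
  · exact ((continuous_stft φ f).aestronglyMeasurable.mul
      (Complex.continuous_ofReal.comp_aestronglyMeasurable hm.1)).smul
      (continuous_tfShift φ).aestronglyMeasurable
  · refine Filter.Eventually.of_forall fun z => ?_
    rw [norm_smul, norm_mul, norm_tfShift, Complex.norm_real]
    calc ‖stft φ f z‖ * ‖m z‖ * ‖φ‖ ≤ ‖φ‖ * ‖f‖ * ‖m z‖ * ‖φ‖ := by
          gcongr; exact norm_stft_le φ f z
      _ = ‖φ‖ * ‖f‖ * ‖φ‖ * ‖m z‖ := by ring

/-- Matrix coefficients of a shifted localization operator: a time-frequency shift modulates the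
symbol and moves the synthesis window. -/
theorem inner_tfShift_locOp {m : ℝ × ℝ → ℝ} (hm : Integrable m) (u : ℝ × ℝ)
    (φ f g : Lp ℂ 2 (volume : Measure ℝ)) :
    inner ℂ g (tfShift u (locOp m φ f)) =
      ∫ z, (symplPhase u z * (m z : ℂ)) * (stft φ f z * conj (stft (tfShift u φ) g z)) := by
  rw [← tfShiftₗᵢ_apply, locOp]
  have h := ((innerSL ℂ g).comp (tfShiftₗᵢ u).toContinuousLinearMap).integral_comp_comm
    (integrable_locOp hm φ f)
  refine h.symm.trans (integral_congr_ae (Filter.Eventually.of_forall fun z => ?_))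
  change inner ℂ g (tfShift u _) = _
  rw [tfShift_smul, inner_smul_right, tfShift_comm, inner_smul_right]
  simp only [stft, inner_conj_symm]
  ring

theorem inner_locOp {m : ℝ × ℝ → ℝ} (hm : Integrable m)
    (φ f g : Lp ℂ 2 (volume : Measure ℝ)) :
    inner ℂ g (locOp m φ f) = ∫ z, (m z : ℂ) * (stft φ f z * conj (stft φ g z)) := by
  have := inner_tfShift_locOp hm 0 φ f g
  simpa only [tfShift_zero, symplPhase_zero_left, one_mul] using this

/-- For a symbol `0 ≤ m ≤ b`, Cauchy–Schwarz for the positive form with density `m` gives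
`‖H_{m,φ} f‖² ≤ b ∫ m |V_φ f|²`. -/
theorem norm_locOp_sq_le {m : ℝ × ℝ → ℝ} (hm : Integrable m) (h0 : ∀ᵐ z, 0 ≤ m z) {b : ℝ}
    (hb0 : 0 < b) (hb : ∀ᵐ z, m z ≤ b) {φ : Lp ℂ 2 (volume : Measure ℝ)} (hφ : ‖φ‖ = 1)
    (f : Lp ℂ 2 (volume : Measure ℝ)) :
    ‖locOp m φ f‖ ^ 2 ≤ b * ∫ z, m z * ‖stft φ f z‖ ^ 2 := by
  set h := locOp m φ f with hh
  have e1 : ‖h‖ ^ 2 = ‖∫ z, (m z : ℂ) * (stft φ f z * conj (stft φ h z))‖ := by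
    rw [← inner_locOp hm, ← hh, inner_self_eq_norm_sq_to_K, norm_pow]
    simp
  have e2 : ‖∫ z, (m z : ℂ) * (stft φ f z * conj (stft φ h z))‖ ≤
      ∫ z, (b / 2 * (m z * ‖stft φ f z‖ ^ 2) + 1 / 2 * ‖stft φ h z‖ ^ 2) := by
    refine norm_integral_le_of_norm_le (((integrable_symbol_mul_norm_stft_sq hm φ f).const_mul _).add
      ((integrable_norm_stft_sq φ h).const_mul _)) ?_
    filter_upwards [h0, hb] with z hz0 hzb
    rw [norm_mul_stft_mul_conj_stft, Complex.norm_real, Real.norm_of_nonneg hz0]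
    set p := ‖stft φ f z‖
    set q := ‖stft φ h z‖
    have hq : m z * q ^ 2 ≤ b * q ^ 2 := by gcongr
    -- the weights `b / 2` and `1 / 2` let the second term be absorbed into `‖H f‖²`
    have h3 : 0 ≤ m z * (b * p - q) ^ 2 := by positivity
    have h4 : b * (m z * (p * q)) ≤ b * (b / 2 * (m z * p ^ 2) + 1 / 2 * q ^ 2) := by nlinarith
    exact le_of_mul_le_mul_left h4 hb0
  rw [integral_add ((integrable_symbol_mul_norm_stft_sq hm φ f).const_mul _)
    ((integrable_norm_stft_sq φ h).const_mul _), integral_const_mul, integral_const_mul,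
    integral_norm_stft_sq, hφ, one_mul] at e2
  linarith

theorem sum_integral_symbol_mul_le {ι : Type*} {η : ι → ℝ × ℝ → ℝ} (hη : ∀ i, Integrable (η i))
    {b : ℝ} (Λ : Finset ι) (hb : ∀ᵐ z, ∑ i ∈ Λ, η i z ≤ b)
    {φ : Lp ℂ 2 (volume : Measure ℝ)} (hφ : ‖φ‖ = 1) (f : Lp ℂ 2 (volume : Measure ℝ)) :
    ∑ i ∈ Λ, ∫ z, η i z * ‖stft φ f z‖ ^ 2 ≤ b * ‖f‖ ^ 2 := by
  rw [← integral_finsetSum _ fun i _ => integrable_symbol_mul_norm_stft_sq (hη i) φ f]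
  calc ∫ z, ∑ i ∈ Λ, η i z * ‖stft φ f z‖ ^ 2 ≤ ∫ z, b * ‖stft φ f z‖ ^ 2 := by
        refine integral_mono_ae
          (integrable_finsetSum _ fun i _ => integrable_symbol_mul_norm_stft_sq (hη i) φ f)
          ((integrable_norm_stft_sq φ f).const_mul b) ?_
        filter_upwards [hb] with z hz
        change ∑ i ∈ Λ, η i z * ‖stft φ f z‖ ^ 2 ≤ b * ‖stft φ f z‖ ^ 2
        rw [← Finset.sum_mul]
        gcongr
    _ = b * ‖f‖ ^ 2 := by rw [integral_const_mul, integral_norm_stft_sq, hφ, one_mul]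

/-! ### Approximate localization of the sum of localization operators -/

section

variable {ι : Type*} (Λ : Finset ι) (node : ι → ℝ × ℝ) (η : ι → ℝ × ℝ → ℝ)
  (φ f : Lp ℂ 2 (volume : Measure ℝ))

/-- The vector `∑ᵢ e_u(-γᵢ) π(u) H_{ηᵢ,φ} f`, where `e_u` is the symplectic phase and `γᵢ` the nodes.
By the commutation relation it is `∑ᵢ H_{ηᵢ,φ} f` with each symbol modulated around its node and
with the synthesis window `π(u) φ`. -/
noncomputable def modulatedSum (u : ℝ × ℝ) : Lp ℂ 2 (volume : Measure ℝ) :=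
  ∑ i ∈ Λ, symplPhase u (-node i) • tfShift u (locOp (η i) φ f)

/-- The total symbol with each summand modulated around its node. -/
noncomputable def modulatedSymbol (u z : ℝ × ℝ) : ℂ :=
  ∑ i ∈ Λ, symplPhase u (z - node i) * (η i z : ℂ)

variable {Λ node η φ f}

theorem aestronglyMeasurable_modulatedSymbol (hη : ∀ i, Integrable (η i)) (u : ℝ × ℝ) :
    AEStronglyMeasurable (modulatedSymbol Λ node η u) := by
  unfold modulatedSymbol
  refine Finset.aestronglyMeasurable_fun_sum _ fun i _ => ?_
  refine AEStronglyMeasurable.mul (Continuous.aestronglyMeasurable ?_)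
    (Complex.continuous_ofReal.comp_aestronglyMeasurable (hη i).1)
  exact continuous_symplPhase.comp (continuous_const.prodMk (continuous_id.sub continuous_const))

theorem norm_modulatedSymbol_le {b : ℝ} (h0 : ∀ i, ∀ᵐ z, 0 ≤ η i z)
    (hb : ∀ᵐ z, ∑ i ∈ Λ, η i z ≤ b) (u : ℝ × ℝ) :
    ∀ᵐ z, ‖modulatedSymbol Λ node η u z‖ ≤ b := by
  have h0' : ∀ᵐ z, ∀ i ∈ Λ, 0 ≤ η i z := (Finset.eventually_all Λ).2 fun i _ => h0 i
  filter_upwards [h0', hb] with z hz hzb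
  refine (norm_sum_le _ _).trans (le_trans (le_of_eq (Finset.sum_congr rfl fun i hi => ?_)) hzb)
  rw [norm_mul, norm_symplPhase, one_mul, Complex.norm_real, Real.norm_of_nonneg (hz i hi)]

theorem inner_modulatedSum (hη : ∀ i, Integrable (η i)) (u : ℝ × ℝ)
    (g : Lp ℂ 2 (volume : Measure ℝ)) :
    inner ℂ g (modulatedSum Λ node η φ f u) =
      ∫ z, modulatedSymbol Λ node η u z * (stft φ f z * conj (stft (tfShift u φ) g z)) := by
  rw [modulatedSum, inner_sum]
  simp_rw [inner_smul_right, inner_tfShift_locOp (hη _), ← integral_const_mul]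
  rw [← integral_finsetSum]
  · refine integral_congr_ae (Filter.Eventually.of_forall fun z => ?_)
    simp only [modulatedSymbol, Finset.sum_mul]
    refine Finset.sum_congr rfl fun i _ => ?_
    rw [sub_eq_add_neg, symplPhase_add]
    ring
  · intro i _
    have h := (integrable_symbol_mul_stft (hη i) φ (tfShift u φ) f g).bdd_mul (c := 1)
      (f := symplPhase u)
      (continuous_symplPhase.comp (continuous_const.prodMk continuous_id)).aestronglyMeasurable
      (Filter.Eventually.of_forall fun z => (norm_symplPhase u z).le)
    refine (h.const_mul (symplPhase u (-node i))).congr (Filter.Eventually.of_forall fun z => ?_)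
    simp only
    ring

theorem norm_modulatedSum_le (hη : ∀ i, Integrable (η i)) {b : ℝ} (hb0 : 0 ≤ b)
    (h0 : ∀ i, ∀ᵐ z, 0 ≤ η i z) (hb : ∀ᵐ z, ∑ i ∈ Λ, η i z ≤ b) (hφ : ‖φ‖ = 1) (u : ℝ × ℝ) :
    ‖modulatedSum Λ node η φ f u‖ ≤ b * ‖f‖ := by
  set S := modulatedSum Λ node η φ f u with hS
  have h1 : ‖S‖ ^ 2 ≤ b * ((‖φ‖ * ‖f‖) * (‖tfShift u φ‖ * ‖S‖)) := by
    refine le_trans (le_of_eq ?_) (norm_integral_mul_stft_mul_conj_stft_le hb0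
      (norm_modulatedSymbol_le (node := node) h0 hb u) φ (tfShift u φ) f S)
    rw [← inner_modulatedSum hη, ← hS, inner_self_eq_norm_sq_to_K, norm_pow]
    simp
  rw [norm_tfShift, hφ, one_mul, one_mul] at h1
  rcases (norm_nonneg S).eq_or_lt with h | h
  · rw [← h]; positivity
  · nlinarith

/-- The modulation of the short-time Fourier transforms of the `H_{ηᵢ,φ} f` around the nodes is a
short-time Fourier transform with the shifted window. -/
theorem stft_modulatedSum (u z : ℝ × ℝ) :
    stft (tfShift u φ) (modulatedSum Λ node η φ f u) z =
      ∑ i ∈ Λ, symplPhase u (z - node i) * stft φ (locOp (η i) φ f) z := by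
  rw [modulatedSum, stft_sum]
  refine Finset.sum_congr rfl fun i _ => ?_
  rw [stft_smul, stft_tfShift_tfShift, sub_eq_add_neg, symplPhase_add]
  ring

theorem modulatedSymbol_zero (z : ℝ × ℝ) :
    modulatedSymbol Λ node η 0 z = ((∑ i ∈ Λ, η i z : ℝ) : ℂ) := by
  simp [modulatedSymbol, symplPhase_zero_left]

/-- Symbols concentrated near their nodes are little affected by modulations around the nodes: part
`t` of the exponent of decay pays for the growth of `|e_u(z) - 1|`. -/
theorem norm_modulatedSymbol_sub_le {s t C K : ℝ} (ht : 0 < t) (ht1 : t ≤ 1) (hC : 0 ≤ C)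
    (hdecay : ∀ i, ∀ᵐ z, |η i z| ≤ C * (1 + ‖z - node i‖) ^ (-s))
    (hK : ∀ z, ∑ i ∈ Λ, (1 + ‖z - node i‖) ^ (-(s - t)) ≤ K) (u : ℝ × ℝ) :
    ∀ᵐ z, ‖modulatedSymbol Λ node η u z - modulatedSymbol Λ node η 0 z‖ ≤
      2 * (4 * Real.pi * ‖u‖) ^ t * C * K := by
  have h0' : ∀ᵐ z, ∀ i ∈ Λ, |η i z| ≤ C * (1 + ‖z - node i‖) ^ (-s) :=
    (Finset.eventually_all Λ).2 fun i _ => hdecay i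
  filter_upwards [h0'] with z hz
  rw [modulatedSymbol, modulatedSymbol, ← Finset.sum_sub_distrib]
  refine (norm_sum_le _ _).trans ?_
  calc ∑ i ∈ Λ, ‖symplPhase u (z - node i) * (η i z : ℂ) - symplPhase 0 (z - node i) * (η i z : ℂ)‖
      ≤ ∑ i ∈ Λ, 2 * (4 * Real.pi * ‖u‖) ^ t * C * (1 + ‖z - node i‖) ^ (-(s - t)) := by
        refine Finset.sum_le_sum fun i hi => ?_
        set r := ‖z - node i‖ with hr
        have hr0 : 0 ≤ r := norm_nonneg _
        rw [symplPhase_zero_left, ← sub_mul, norm_mul, Complex.norm_real, Real.norm_eq_abs]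
        have h1 := norm_symplPhase_sub_one_le u (z - node i) ht ht1
        rw [← hr, Real.mul_rpow (by positivity) hr0] at h1
        calc ‖symplPhase u (z - node i) - 1‖ * |η i z|
            ≤ (2 * ((4 * Real.pi * ‖u‖) ^ t * r ^ t)) * (C * (1 + r) ^ (-s)) :=
              mul_le_mul h1 (hz i hi) (abs_nonneg _) (by positivity)
          _ ≤ (2 * ((4 * Real.pi * ‖u‖) ^ t * (1 + r) ^ t)) * (C * (1 + r) ^ (-s)) := by
              gcongr; linarith
          _ = 2 * (4 * Real.pi * ‖u‖) ^ t * C * ((1 + r) ^ t * (1 + r) ^ (-s)) := by ring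
          _ = _ := by
              rw [← Real.rpow_add (by positivity)]
              congr 2
              ring
    _ = 2 * (4 * Real.pi * ‖u‖) ^ t * C * ∑ i ∈ Λ, (1 + ‖z - node i‖) ^ (-(s - t)) := by
        rw [Finset.mul_sum]
    _ ≤ _ := by gcongr; exact hK z

/-- Modulating the summands around their nodes by a small frequency changes the form
`⟨∑ᵢ V_φ H_{ηᵢ,φ} f, V_φ f⟩` by little: the modulation of the phase space function is undone by a
small time-frequency shift of the window, and the modulation of the symbols is undone because they
are concentrated near their nodes. -/
theorem norm_integral_modulated_sub_le (hη : ∀ i, Integrable (η i)) {b : ℝ} (hb0 : 0 ≤ b)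
    (h0 : ∀ i, ∀ᵐ z, 0 ≤ η i z) (hb : ∀ᵐ z, ∑ i ∈ Λ, η i z ≤ b) (hφ : ‖φ‖ = 1) {u : ℝ × ℝ} {κ : ℝ}
    (hκ0 : 0 ≤ κ)
    (hκ : ∀ᵐ z, ‖modulatedSymbol Λ node η u z - modulatedSymbol Λ node η 0 z‖ ≤ κ) :
    ‖(∫ z, (∑ i ∈ Λ, symplPhase u (z - node i) * stft φ (locOp (η i) φ f) z) * conj (stft φ f z))
        - ((∑ i ∈ Λ, ∫ z, η i z * ‖stft φ f z‖ ^ 2 : ℝ) : ℂ)‖ ≤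
      (2 * b * ‖tfShift u φ - φ‖ + κ) * ‖f‖ ^ 2 := by
  set S := modulatedSum Λ node η φ f u with hS
  set ρ := ‖tfShift u φ - φ‖ with hρ
  have hS_le : ‖S‖ ≤ b * ‖f‖ := norm_modulatedSum_le hη hb0 h0 hb hφ u
  have hbm : ∀ᵐ z : ℝ × ℝ, ‖(1 : ℂ)‖ ≤ 1 := Filter.Eventually.of_forall fun _ => by simp
  have hm1 : AEStronglyMeasurable (fun _ : ℝ × ℝ => (1 : ℂ)) := aestronglyMeasurable_const
  -- removal of the shift of the analysing window
  have e1 : ∫ z, (∑ i ∈ Λ, symplPhase u (z - node i) * stft φ (locOp (η i) φ f) z)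
        * conj (stft φ f z) =
      inner ℂ f S + ∫ z, 1 * (stft (tfShift u φ - φ) S z * conj (stft φ f z)) := by
    rw [← integral_stft_mul_conj_stft hφ, ← integral_add]
    · refine integral_congr_ae (Filter.Eventually.of_forall fun z => ?_)
      simp only
      rw [← stft_modulatedSum, ← hS, stft_sub_left]
      ring
    · simpa only [one_mul] using integrable_mul_stft_mul_conj_stft hm1 hbm φ φ S f
    · exact integrable_mul_stft_mul_conj_stft hm1 hbm _ φ S f
  have b1 : ‖∫ z, 1 * (stft (tfShift u φ - φ) S z * conj (stft φ f z))‖ ≤ b * ρ * ‖f‖ ^ 2 := by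
    refine (norm_integral_mul_stft_mul_conj_stft_le zero_le_one hbm _ _ _ _).trans ?_
    rw [hφ, ← hρ]
    calc 1 * (ρ * ‖S‖ * (1 * ‖f‖)) ≤ 1 * (ρ * (b * ‖f‖) * (1 * ‖f‖)) := by gcongr
      _ = b * ρ * ‖f‖ ^ 2 := by ring
  -- removal of the shift of the synthesis window and of the modulation of the symbols
  have hMu := norm_modulatedSymbol_le (node := node) h0 hb u
  have hM0 := norm_modulatedSymbol_le (node := node) h0 hb 0
  have mMu := aestronglyMeasurable_modulatedSymbol (Λ := Λ) (node := node) hη u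
  have mM0 := aestronglyMeasurable_modulatedSymbol (Λ := Λ) (node := node) hη 0
  have mD : AEStronglyMeasurable
      fun z => modulatedSymbol Λ node η u z - modulatedSymbol Λ node η 0 z := mMu.sub mM0
  have e0 : ((∑ i ∈ Λ, ∫ z, η i z * ‖stft φ f z‖ ^ 2 : ℝ) : ℂ) =
      ∫ z, modulatedSymbol Λ node η 0 z * (stft φ f z * conj (stft φ f z)) := by
    rw [← integral_finsetSum _ fun i _ => integrable_symbol_mul_norm_stft_sq (hη i) φ f,
      ← integral_complex_ofReal]
    refine integral_congr_ae (Filter.Eventually.of_forall fun z => ?_)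
    simp only
    rw [modulatedSymbol_zero, Complex.mul_conj, Complex.normSq_eq_norm_sq, ← Finset.sum_mul]
    push_cast
    ring
  have e2 : inner ℂ f S - ((∑ i ∈ Λ, ∫ z, η i z * ‖stft φ f z‖ ^ 2 : ℝ) : ℂ) =
      (∫ z, (modulatedSymbol Λ node η u z - modulatedSymbol Λ node η 0 z) *
        (stft φ f z * conj (stft φ f z))) +
      ∫ z, modulatedSymbol Λ node η u z *
        (stft φ f z * conj (stft (tfShift u φ - φ) f z)) := by
    rw [e0, hS, inner_modulatedSum hη, ← integral_sub
      (integrable_mul_stft_mul_conj_stft mMu hMu φ _ f f)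
      (integrable_mul_stft_mul_conj_stft mM0 hM0 φ _ f f), ← integral_add
      (integrable_mul_stft_mul_conj_stft mD hκ φ _ f f)
      (integrable_mul_stft_mul_conj_stft mMu hMu φ _ f f)]
    refine integral_congr_ae (Filter.Eventually.of_forall fun z => ?_)
    simp only [stft_sub_left, map_sub]
    ring
  have b2 : ‖∫ z, (modulatedSymbol Λ node η u z - modulatedSymbol Λ node η 0 z) *
      (stft φ f z * conj (stft φ f z))‖ ≤ κ * ‖f‖ ^ 2 := by
    refine (norm_integral_mul_stft_mul_conj_stft_le hκ0 hκ _ _ _ _).trans (le_of_eq ?_)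
    rw [hφ]
    ring
  have b3 : ‖∫ z, modulatedSymbol Λ node η u z *
      (stft φ f z * conj (stft (tfShift u φ - φ) f z))‖ ≤ b * ρ * ‖f‖ ^ 2 := by
    refine (norm_integral_mul_stft_mul_conj_stft_le hb0 hMu _ _ _ _).trans (le_of_eq ?_)
    rw [hφ, ← hρ]
    ring
  rw [e1, add_sub_right_comm, e2]
  refine (norm_add₃_le).trans ?_
  linarith

end

/-- Fubini: cutting off `F` around a point by the symplectic Fourier transform of `τ` is averaging
its modulations with density `τ`. -/
theorem integral_symplFourier_mul {τ : ℝ × ℝ → ℝ} (hτ : Integrable τ) {F : ℝ × ℝ → ℂ}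
    (hF : Integrable F) (γ : ℝ × ℝ) :
    Integrable (fun u => (τ u : ℂ) * ∫ z, symplPhase u (z - γ) * F z) ∧
    ∫ z, (∫ u, (τ u : ℂ) * symplPhase u (z - γ)) * F z =
      ∫ u, (τ u : ℂ) * ∫ z, symplPhase u (z - γ) * F z := by
  have hprod : Integrable (fun p : (ℝ × ℝ) × (ℝ × ℝ) =>
      symplPhase p.1 (p.2 - γ) * ((τ p.1 : ℂ) * F p.2)) (volume.prod volume) := by
    refine (hτ.ofReal.mul_prod hF).bdd_mul (c := 1) (Continuous.aestronglyMeasurable ?_)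
      (Filter.Eventually.of_forall fun p => (norm_symplPhase _ _).le)
    exact continuous_symplPhase.comp
      (continuous_fst.prodMk (continuous_snd.sub continuous_const))
  have hinner : ∀ u : ℝ × ℝ, ∫ z, symplPhase u (z - γ) * ((τ u : ℂ) * F z) =
      (τ u : ℂ) * ∫ z, symplPhase u (z - γ) * F z := by
    intro u
    rw [← integral_const_mul]
    congr 1 with z
    ring
  have hinner' : ∀ z : ℝ × ℝ, ∫ u, symplPhase u (z - γ) * ((τ u : ℂ) * F z) =
      (∫ u, (τ u : ℂ) * symplPhase u (z - γ)) * F z := by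
    intro z
    rw [← integral_mul_const]
    congr 1 with u
    ring
  constructor
  · simpa only [hinner] using hprod.integral_prod_left
  · have := integral_integral_swap
      (f := fun u z => symplPhase u (z - γ) * ((τ u : ℂ) * F z)) hprod
    simp only [hinner, hinner'] at this
    exact this.symm

theorem integrable_stft_mul_conj_stft (φ ψ f g : Lp ℂ 2 (volume : Measure ℝ)) :
    Integrable fun z => stft φ f z * conj (stft ψ g z) :=
  (memLp_stft φ f).integrable_mul (memLp_stft ψ g).star

/-- The energy `∑ᵢ ⟨H_{ηᵢ,φ} f, f⟩ = ∑ᵢ ∫ ηᵢ |V_φ f|²` is controlled by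
`∑ᵢ ‖H_{ηᵢ,φ} f‖²` up to an arbitrarily small multiple of `‖f‖²`, uniformly over finite
subfamilies. -/
theorem exists_sum_energy_le {ι : Type*} {node : ι → ℝ × ℝ} (hnode : RelSeparated node)
    {η : ι → ℝ × ℝ → ℝ} (hη : ∀ i, Integrable (η i)) (h0 : ∀ i, ∀ᵐ z, 0 ≤ η i z)
    {s C : ℝ} (hs : 2 < s) (hC : 0 ≤ C)
    (hdecay : ∀ i, ∀ᵐ z, |η i z| ≤ C * (1 + ‖z - node i‖) ^ (-s))
    {b : ℝ} (hb0 : 0 ≤ b) (hb : ∀ Λ : Finset ι, ∀ᵐ z, ∑ i ∈ Λ, η i z ≤ b)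
    {φ : Lp ℂ 2 (volume : Measure ℝ)} (hφ : ‖φ‖ = 1) {ε : ℝ} (hε : 0 < ε) :
    ∃ D : ℝ, 0 < D ∧ ∀ (f : Lp ℂ 2 (volume : Measure ℝ)) (Λ : Finset ι),
      ∑ i ∈ Λ, ∫ z, η i z * ‖stft φ f z‖ ^ 2 ≤
        D * ∑ i ∈ Λ, ‖locOp (η i) φ f‖ ^ 2 + ε * ‖f‖ ^ 2 := by
  -- an exponent `t` such that `|z|ᵗ` may be absorbed into the decay of the symbols
  set t := min 1 ((s - 2) / 2) with ht
  have ht0 : 0 < t := lt_min one_pos (by linarith)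
  have ht1 : t ≤ 1 := min_le_left _ _
  have hst : 2 < s - t := by
    have : t ≤ (s - 2) / 2 := min_le_right _ _
    linarith
  obtain ⟨K, hK0, hK⟩ := hnode.exists_sum_le hst
  obtain ⟨K', hK'0, hK'⟩ := hnode.exists_sum_le (s := 4) (by norm_num)
  -- the radius `δ` within which modulations cost at most `ε / 2`
  obtain ⟨δ, hδ, hδε⟩ : ∃ δ > 0, ∀ u : ℝ × ℝ, ‖u‖ < δ →
      2 * b * ‖tfShift u φ - φ‖ + 2 * (4 * Real.pi * ‖u‖) ^ t * C * K < ε / 2 := by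
    have hcont : Continuous fun u : ℝ × ℝ =>
        2 * b * ‖tfShift u φ - φ‖ + 2 * (4 * Real.pi * ‖u‖) ^ t * C * K := by
      have h1 := continuous_tfShift φ
      have h2 : Continuous fun u : ℝ × ℝ => (4 * Real.pi * ‖u‖) ^ t :=
        Continuous.rpow_const (by fun_prop) fun _ => Or.inr ht0.le
      fun_prop
    have h := hcont.tendsto 0
    have hz : 2 * b * ‖tfShift 0 φ - φ‖ + 2 * (4 * Real.pi * ‖(0 : ℝ × ℝ)‖) ^ t * C * K = 0 := by
      simp [tfShift_zero, Real.zero_rpow ht0.ne']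
    rw [hz] at h
    obtain ⟨δ, hδ, hδ'⟩ := Metric.eventually_nhds_iff.1 (h.eventually_lt_const (half_pos hε))
    exact ⟨δ, hδ, fun u hu => hδ' (by rwa [dist_zero_right])⟩
  obtain ⟨τ, hτ0, hτint, hτ1, hτsupp, B, hB⟩ := exists_concentrated_kernel hδ
  set θ : ℝ × ℝ → ℂ := fun z => ∫ u, (τ u : ℂ) * symplPhase u z with hθ
  -- `T` is large enough for `∑ᵢ |θ(z - γᵢ)|² / (2T)` to be at most `ε / 2`
  set T := B ^ 2 * K' / ε + 1 with hT
  have hT0 : 0 < T := by positivity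
  refine ⟨T / 2, by positivity, fun f Λ => ?_⟩
  set E := ∑ i ∈ Λ, ∫ z, η i z * ‖stft φ f z‖ ^ 2 with hE
  set F : ι → ℝ × ℝ → ℂ := fun i z => stft φ (locOp (η i) φ f) z * conj (stft φ f z) with hFdef
  have hF : ∀ i, Integrable (F i) := fun i => integrable_stft_mul_conj_stft _ _ _ _
  set G : ℝ × ℝ → ℂ := fun u => ∑ i ∈ Λ, ∫ z, symplPhase u (z - node i) * F i z with hG
  -- the localized form `Q` is an average of its modulations `G u` over small `u`
  have hτG : Integrable fun u => (τ u : ℂ) * G u := by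
    simp only [hG, Finset.mul_sum]
    exact integrable_finsetSum _ fun i _ => (integral_symplFourier_mul hτint (hF i) (node i)).1
  have hQ : ∑ i ∈ Λ, ∫ z, θ (z - node i) * F i z = ∫ u, (τ u : ℂ) * G u := by
    simp only [hG, Finset.mul_sum]
    rw [integral_finsetSum _ fun i _ => (integral_symplFourier_mul hτint (hF i) (node i)).1]
    exact Finset.sum_congr rfl fun i _ => (integral_symplFourier_mul hτint (hF i) (node i)).2
  have hGE : ∀ u, τ u ≠ 0 → ‖G u - (E : ℂ)‖ ≤ ε / 2 * ‖f‖ ^ 2 := by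
    intro u hu
    have hmod := norm_integral_modulated_sub_le hη hb0 h0 (hb Λ) hφ (f := f) (u := u) (node := node)
      (by positivity) (norm_modulatedSymbol_sub_le ht0 ht1 hC hdecay (hK Λ) u)
    have hGu : G u = ∫ z, (∑ i ∈ Λ, symplPhase u (z - node i) * stft φ (locOp (η i) φ f) z) *
        conj (stft φ f z) := by
      rw [hG]
      simp only
      rw [← integral_finsetSum]
      · refine integral_congr_ae (Filter.Eventually.of_forall fun z => ?_)
        simp only [hFdef, Finset.sum_mul, mul_assoc]
      · intro i _
        refine (hF i).bdd_mul (c := 1) (Continuous.aestronglyMeasurable ?_)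
          (Filter.Eventually.of_forall fun z => (norm_symplPhase u _).le)
        exact continuous_symplPhase.comp
          (continuous_const.prodMk (continuous_id.sub continuous_const))
    rw [hGu]
    refine hmod.trans ?_
    gcongr
    exact (hδε u (hτsupp u hu)).le
  have hQE : ‖(∑ i ∈ Λ, ∫ z, θ (z - node i) * F i z) - (E : ℂ)‖ ≤ ε / 2 * ‖f‖ ^ 2 := by
    have hE1 : (E : ℂ) = ∫ u, (τ u : ℂ) * (E : ℂ) := by
      rw [integral_mul_const, integral_complex_ofReal, hτ1, Complex.ofReal_one, one_mul]
    have hτE : Integrable fun u => (τ u : ℂ) * (E : ℂ) := hτint.ofReal.mul_const _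
    rw [hQ, hE1, ← integral_sub hτG hτE]
    calc ‖∫ u, ((τ u : ℂ) * G u - (τ u : ℂ) * (E : ℂ))‖ ≤ ∫ u, τ u * (ε / 2 * ‖f‖ ^ 2) := by
          refine norm_integral_le_of_norm_le (hτint.mul_const _)
            (Filter.Eventually.of_forall fun u => ?_)
          rw [← mul_sub, norm_mul, Complex.norm_real, Real.norm_of_nonneg (hτ0 u)]
          rcases eq_or_ne (τ u) 0 with h | h
          · simp [h]
          · exact mul_le_mul_of_nonneg_left (hGE u h) (hτ0 u)
      _ = ε / 2 * ‖f‖ ^ 2 := by rw [integral_mul_const, hτ1, one_mul]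
  -- the localized form is bounded by Cauchy-Schwarz, with weights `T` and `1 / T`
  have hθm : ∀ z, ∑ i ∈ Λ, ‖θ (z - node i)‖ ^ 2 ≤ B ^ 2 * K' := by
    intro z
    calc ∑ i ∈ Λ, ‖θ (z - node i)‖ ^ 2 ≤ ∑ i ∈ Λ, B ^ 2 * (1 + ‖z - node i‖) ^ (-4 : ℝ) := by
          refine Finset.sum_le_sum fun i _ => ?_
          refine (pow_le_pow_left₀ (norm_nonneg _) (hB (z - node i)) 2).trans (le_of_eq ?_)
          rw [mul_pow, ← Real.rpow_mul_natCast (by positivity)]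
          norm_num
      _ ≤ B ^ 2 * K' := by
          rw [← Finset.mul_sum]
          exact mul_le_mul_of_nonneg_left (hK' Λ z) (sq_nonneg B)
  have hQle : ‖∑ i ∈ Λ, ∫ z, θ (z - node i) * F i z‖ ≤
      T / 2 * ∑ i ∈ Λ, ‖locOp (η i) φ f‖ ^ 2 + ε / 2 * ‖f‖ ^ 2 := by
    have hX : ∑ i ∈ Λ, ‖locOp (η i) φ f‖ ^ 2 =
        ∫ z, ∑ i ∈ Λ, ‖stft φ (locOp (η i) φ f) z‖ ^ 2 := by
      rw [integral_finsetSum _ fun i _ => integrable_norm_stft_sq _ _]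
      simp_rw [integral_norm_stft_sq, hφ, one_mul]
    have hθF : ∀ i, Integrable fun z => θ (z - node i) * F i z := by
      intro i
      refine (hF i).bdd_mul (c := B) ?_ (Filter.Eventually.of_forall fun z => ?_)
      · have hθc : Continuous θ := by
          refine continuous_of_dominated (bound := fun u => τ u) (fun z => ?_) (fun z => ?_)
            hτint (Filter.Eventually.of_forall fun u => ?_)
          · exact hτint.ofReal.1.mul (Continuous.aestronglyMeasurable
              (continuous_symplPhase.comp (continuous_id.prodMk continuous_const)))
          · refine Filter.Eventually.of_forall fun u => ?_
            rw [norm_mul, norm_symplPhase, mul_one, Complex.norm_real,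
              Real.norm_of_nonneg (hτ0 u)]
          · exact continuous_const.mul
              (continuous_symplPhase.comp (continuous_const.prodMk continuous_id))
        exact (hθc.comp (continuous_id.sub continuous_const)).aestronglyMeasurable
      · have h1 := hB (z - node i)
        have h2 : (1 + ‖z - node i‖) ^ (-2 : ℝ) ≤ 1 :=
          Real.rpow_le_one_of_one_le_of_nonpos (by simp) (by norm_num)
        have h3 : 0 < (1 + ‖z - node i‖) ^ (-2 : ℝ) := by positivity
        have hB0 : 0 ≤ B := nonneg_of_mul_nonneg_left ((norm_nonneg _).trans h1) h3
        exact h1.trans (mul_le_of_le_one_right hB0 h2)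
    have hXint : Integrable fun z => ∑ i ∈ Λ, ‖stft φ (locOp (η i) φ f) z‖ ^ 2 :=
      integrable_finsetSum _ fun i _ => integrable_norm_stft_sq _ _
    rw [hX, ← integral_finsetSum _ fun i _ => hθF i]
    calc ‖∫ z, ∑ i ∈ Λ, θ (z - node i) * F i z‖
        ≤ ∫ z, (T / 2 * ∑ i ∈ Λ, ‖stft φ (locOp (η i) φ f) z‖ ^ 2
            + ε / 2 * ‖stft φ f z‖ ^ 2) := by
          refine norm_integral_le_of_norm_le ((hXint.const_mul _).add
            ((integrable_norm_stft_sq φ f).const_mul _)) (Filter.Eventually.of_forall fun z => ?_)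
          set q := ‖stft φ f z‖ with hq
          calc ‖∑ i ∈ Λ, θ (z - node i) * F i z‖
              ≤ ∑ i ∈ Λ, (T / 2 * ‖stft φ (locOp (η i) φ f) z‖ ^ 2
                + q ^ 2 / (2 * T) * ‖θ (z - node i)‖ ^ 2) := by
                refine (norm_sum_le _ _).trans (Finset.sum_le_sum fun i _ => ?_)
                simp only [hFdef]
                rw [norm_mul, norm_mul, RCLike.norm_conj, ← hq]
                set p := ‖stft φ (locOp (η i) φ f) z‖
                set r := ‖θ (z - node i)‖
                have h1 : 0 ≤ (T * p - q * r) ^ 2 / (2 * T) := by positivity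
                have h2 : (T * p - q * r) ^ 2 / (2 * T) =
                    T / 2 * p ^ 2 + q ^ 2 / (2 * T) * r ^ 2 - r * (p * q) := by
                  field_simp
                  ring
                linarith
            _ = T / 2 * ∑ i ∈ Λ, ‖stft φ (locOp (η i) φ f) z‖ ^ 2
                + q ^ 2 / (2 * T) * ∑ i ∈ Λ, ‖θ (z - node i)‖ ^ 2 := by
                rw [Finset.sum_add_distrib, Finset.mul_sum, Finset.mul_sum]
            _ ≤ T / 2 * ∑ i ∈ Λ, ‖stft φ (locOp (η i) φ f) z‖ ^ 2
                + q ^ 2 / (2 * T) * (ε * T) := by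
                gcongr
                refine (hθm z).trans ?_
                rw [hT, mul_add, mul_div_cancel₀ _ hε.ne']
                linarith
            _ = _ := by
                field_simp
      _ = _ := by
          rw [integral_add (hXint.const_mul _) ((integrable_norm_stft_sq φ f).const_mul _),
            integral_const_mul, integral_const_mul, integral_norm_stft_sq φ f, hφ, one_mul]
  have hEle : E ≤ ‖(E : ℂ)‖ := by rw [Complex.norm_real]; exact le_abs_self E
  have htri := norm_sub_norm_le (E : ℂ) (∑ i ∈ Λ, ∫ z, θ (z - node i) * F i z)
  rw [norm_sub_rev] at htri
  linarith

/-! ### Two windows -/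

/-- The pointwise minimum of the two transforms keeps a quarter of the energy when the windows are
at distance less than `1 / 2`, because `|V₀|² ≤ 2 min² + 2 |V₀ - V₁|²`. -/
theorem quarter_norm_sq_le_integral_min_sq {φ : Fin 2 → Lp ℂ 2 (volume : Measure ℝ)}
    (hφ : ∀ i, ‖φ i‖ = 1) (hdist : ‖φ 0 - φ 1‖ < 1 / 2) (f : Lp ℂ 2 (volume : Measure ℝ)) :
    Integrable (fun z => min ‖stft (φ 0) f z‖ ‖stft (φ 1) f z‖ ^ 2) ∧
    1 / 4 * ‖f‖ ^ 2 ≤ ∫ z, min ‖stft (φ 0) f z‖ ‖stft (φ 1) f z‖ ^ 2 := by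
  have hint : Integrable (fun z => min ‖stft (φ 0) f z‖ ‖stft (φ 1) f z‖ ^ 2) := by
    refine (integrable_norm_stft_sq (φ 0) f).mono' (((continuous_stft (φ 0) f).norm.min
      (continuous_stft (φ 1) f).norm).pow 2).aestronglyMeasurable
      (Filter.Eventually.of_forall fun z => ?_)
    have h0 : 0 ≤ min ‖stft (φ 0) f z‖ ‖stft (φ 1) f z‖ := by positivity
    rw [Real.norm_of_nonneg (by positivity)]
    exact pow_le_pow_left₀ h0 (min_le_left _ _) 2
  refine ⟨hint, ?_⟩
  have h1 : ∫ z, ‖stft (φ 0) f z‖ ^ 2 ≤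
      ∫ z, (2 * min ‖stft (φ 0) f z‖ ‖stft (φ 1) f z‖ ^ 2 + 2 * ‖stft (φ 0 - φ 1) f z‖ ^ 2) := by
    refine integral_mono (integrable_norm_stft_sq _ _)
      ((hint.const_mul 2).add ((integrable_norm_stft_sq _ _).const_mul 2)) fun z => ?_
    change ‖stft (φ 0) f z‖ ^ 2 ≤
      2 * min ‖stft (φ 0) f z‖ ‖stft (φ 1) f z‖ ^ 2 + 2 * ‖stft (φ 0 - φ 1) f z‖ ^ 2
    rw [stft_sub_left]
    have htri := norm_sub_norm_le (stft (φ 0) f z) (stft (φ 1) f z)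
    have hle : ‖stft (φ 0) f z‖ ≤ min ‖stft (φ 0) f z‖ ‖stft (φ 1) f z‖ +
        ‖stft (φ 0) f z - stft (φ 1) f z‖ := by
      have := norm_nonneg (stft (φ 0) f z - stft (φ 1) f z)
      rcases min_cases ‖stft (φ 0) f z‖ ‖stft (φ 1) f z‖ with ⟨h, _⟩ | ⟨h, _⟩ <;> rw [h] <;> linarith
    exact (pow_le_pow_left₀ (norm_nonneg _) hle 2).trans (by
      rw [← mul_add]; exact add_sq_le)
  rw [integral_add (hint.const_mul 2) ((integrable_norm_stft_sq _ _).const_mul 2),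
    integral_const_mul, integral_const_mul, integral_norm_stft_sq, integral_norm_stft_sq, hφ,
    one_mul, mul_pow] at h1
  have h2 : ‖φ 0 - φ 1‖ ^ 2 * ‖f‖ ^ 2 ≤ 1 / 4 * ‖f‖ ^ 2 := by
    gcongr
    calc ‖φ 0 - φ 1‖ ^ 2 ≤ (1 / 2) ^ 2 := pow_le_pow_left₀ (norm_nonneg _) hdist.le 2
      _ = 1 / 4 := by norm_num
  linarith

/-- The total energy `∑ᵢ ∑_γ ⟨H_{η_γ,φᵢ} f, f⟩` is bounded below. -/
theorem le_total_energy {κ : Fin 2 → Type*} [∀ i, Countable (κ i)]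
    {η : (i : Fin 2) → κ i → ℝ × ℝ → ℝ} (hη : ∀ i γ, Integrable (η i γ))
    (h0 : ∀ᵐ z : ℝ × ℝ, ∀ i γ, 0 ≤ η i γ z) {a : ℝ} (ha : 0 < a)
    (hsum : ∀ᵐ z : ℝ × ℝ, (∀ i, Summable fun γ => η i γ z) ∧ a ≤ ∑ i, ∑' γ, η i γ z)
    {φ : Fin 2 → Lp ℂ 2 (volume : Measure ℝ)} (hφ : ∀ i, ‖φ i‖ = 1)
    (hdist : ‖φ 0 - φ 1‖ < 1 / 2) (f : Lp ℂ 2 (volume : Measure ℝ))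
    (hE : ∀ i, Summable fun γ => ∫ z, η i γ z * ‖stft (φ i) f z‖ ^ 2) :
    a / 4 * ‖f‖ ^ 2 ≤ ∑ i, ∑' γ, ∫ z, η i γ z * ‖stft (φ i) f z‖ ^ 2 := by
  obtain ⟨hmin, hq⟩ := quarter_norm_sq_le_integral_min_sq hφ hdist f
  set n : ℝ × ℝ → ℝ := fun z => min ‖stft (φ 0) f z‖ ‖stft (φ 1) f z‖ ^ 2 with hn
  have h0' : ∀ i γ, ∀ᵐ z : ℝ × ℝ, 0 ≤ η i γ z * ‖stft (φ i) f z‖ ^ 2 := fun i γ => by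
    filter_upwards [h0] with z hz
    exact mul_nonneg (hz i γ) (sq_nonneg _)
  have hE0 : ∀ i γ, 0 ≤ ∫ z, η i γ z * ‖stft (φ i) f z‖ ^ 2 := fun i γ =>
    integral_nonneg_of_ae (h0' i γ)
  have hnn : ∀ z, 0 ≤ a * n z := fun z => by positivity
  have hpt : ∀ᵐ z : ℝ × ℝ, ENNReal.ofReal (a * n z) ≤
      ∑ i, ∑' γ, ENNReal.ofReal (η i γ z * ‖stft (φ i) f z‖ ^ 2) := by
    filter_upwards [h0, hsum] with z hz ⟨hzs, hza⟩
    have hs : ∀ i, Summable fun γ => η i γ z * ‖stft (φ i) f z‖ ^ 2 := fun i =>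
      (hzs i).mul_right _
    have hnn' : ∀ i γ, 0 ≤ η i γ z * ‖stft (φ i) f z‖ ^ 2 := fun i γ =>
      mul_nonneg (hz i γ) (sq_nonneg _)
    simp_rw [← ENNReal.ofReal_tsum_of_nonneg (hnn' _) (hs _)]
    rw [← ENNReal.ofReal_sum_of_nonneg fun i _ => tsum_nonneg (hnn' i)]
    refine ENNReal.ofReal_le_ofReal ?_
    have hle : ∀ i, n z ≤ ‖stft (φ i) f z‖ ^ 2 := by
      have hm0 : 0 ≤ min ‖stft (φ 0) f z‖ ‖stft (φ 1) f z‖ := by positivity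
      intro i
      fin_cases i
      · exact pow_le_pow_left₀ hm0 (min_le_left _ _) 2
      · exact pow_le_pow_left₀ hm0 (min_le_right _ _) 2
    calc a * n z ≤ (∑ i, ∑' γ, η i γ z) * n z := by
          gcongr
      _ = ∑ i, (∑' γ, η i γ z) * n z := Finset.sum_mul _ _ _
      _ ≤ ∑ i, (∑' γ, η i γ z) * ‖stft (φ i) f z‖ ^ 2 := by
          refine Finset.sum_le_sum fun i _ => ?_
          exact mul_le_mul_of_nonneg_left (hle i) (tsum_nonneg (hz i))
      _ = _ := by simp_rw [tsum_mul_right]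
  have hl := lintegral_mono_ae hpt
  have hmeas : ∀ i γ, AEMeasurable
      fun z => ENNReal.ofReal (η i γ z * ‖stft (φ i) f z‖ ^ 2) := fun i γ =>
    (integrable_symbol_mul_norm_stft_sq (hη i γ) (φ i) f).1.aemeasurable.ennreal_ofReal
  rw [← ofReal_integral_eq_lintegral_ofReal (hmin.const_mul a)
      (Filter.Eventually.of_forall hnn), integral_const_mul,
    lintegral_finsetSum' _ fun i _ => AEMeasurable.tsum (hmeas i)] at hl
  simp_rw [lintegral_tsum (hmeas _)] at hl
  have he : ∀ i γ, ∫⁻ z, ENNReal.ofReal (η i γ z * ‖stft (φ i) f z‖ ^ 2) =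
      ENNReal.ofReal (∫ z, η i γ z * ‖stft (φ i) f z‖ ^ 2) := fun i γ =>
    (ofReal_integral_eq_lintegral_ofReal
      (integrable_symbol_mul_norm_stft_sq (hη i γ) (φ i) f) (h0' i γ)).symm
  simp_rw [he, ← ENNReal.ofReal_tsum_of_nonneg (hE0 _) (hE _)] at hl
  rw [← ENNReal.ofReal_sum_of_nonneg fun i _ => tsum_nonneg (hE0 i),
    ENNReal.ofReal_le_ofReal_iff (Finset.sum_nonneg fun i _ => tsum_nonneg (hE0 i))] at hl
  nlinarith

theorem mainTheorem2
    (φ : Fin 2 → Lp ℂ 2 (volume : Measure ℝ)) (hφ : ∀ i, ‖φ i‖ = 1)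
    (hdist : ‖φ 0 - φ 1‖ < 1 / 2)
    (Γ : Fin 2 → Set (ℝ × ℝ)) (η : (i : Fin 2) → Γ i → ℝ × ℝ → ℝ)
    (hws : WellSpread (fun p : (i : Fin 2) × Γ i => (p.2 : ℝ × ℝ)) (fun p => η p.1 p.2))
    (hnonneg : ∀ i (γ : Γ i), ∀ᵐ z : ℝ × ℝ, 0 ≤ η i γ z)
    (hsum : ∃ a b : ℝ, 0 < a ∧ ∀ᵐ z : ℝ × ℝ, (∀ i, Summable fun γ : Γ i => η i γ z) ∧
      a ≤ ∑ i, ∑' γ : Γ i, η i γ z ∧ ∑ i, ∑' γ : Γ i, η i γ z ≤ b) :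
    ∃ A B : ℝ, 0 < A ∧ A ≤ B ∧ ∀ f : Lp ℂ 2 (volume : Measure ℝ),
      (∀ i, Summable fun γ : Γ i => ‖locOp (η i γ) (φ i) f‖ ^ 2) ∧
      A * ‖f‖ ^ 2 ≤ ∑ i, ∑' γ : Γ i, ‖locOp (η i γ) (φ i) f‖ ^ 2 ∧
      ∑ i, ∑' γ : Γ i, ‖locOp (η i γ) (φ i) f‖ ^ 2 ≤ B * ‖f‖ ^ 2 := by
  obtain ⟨hsep, hint, g, -, -, ⟨C, s, hs, hg⟩, hηg⟩ := hws
  obtain ⟨a, b, ha, hab⟩ := hsum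
  have hsepi : ∀ i, RelSeparated fun γ : Γ i => (γ : ℝ × ℝ) := fun i =>
    hsep.comp_injective (e := Sigma.mk i) sigma_mk_injective
  have hcount : ∀ i, Countable (Γ i) := fun i => (hsepi i).countable
  have hη : ∀ i (γ : Γ i), Integrable (η i γ) := fun i γ => hint ⟨i, γ⟩
  have hC : 0 ≤ C := by simpa using (abs_nonneg _).trans (hg 0)
  have hdecay : ∀ i (γ : Γ i), ∀ᵐ z : ℝ × ℝ,
      |η i γ z| ≤ C * (1 + ‖z - (γ : ℝ × ℝ)‖) ^ (-s) := fun i γ => by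
    filter_upwards [hηg ⟨i, γ⟩] with z hz
    exact (hz.trans (le_abs_self _)).trans (hg _)
  have h0 : ∀ᵐ z : ℝ × ℝ, ∀ i (γ : Γ i), 0 ≤ η i γ z :=
    ae_all_iff.2 fun i => ae_all_iff.2 fun γ => hnonneg i γ
  have hb0 : 0 < b := by
    obtain ⟨z, -, h1, h2⟩ := hab.exists
    linarith
  have hfin : ∀ i (Λ : Finset (Γ i)), ∀ᵐ z : ℝ × ℝ, ∑ γ ∈ Λ, η i γ z ≤ b := by
    intro i Λ
    filter_upwards [h0, hab] with z hz ⟨hzs, _, hzb⟩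
    calc ∑ γ ∈ Λ, η i γ z ≤ ∑' γ, η i γ z := (hzs i).sum_le_tsum Λ fun γ _ => hz i γ
      _ ≤ ∑ j, ∑' γ : Γ j, η j γ z :=
        Finset.single_le_sum (f := fun j => ∑' γ : Γ j, η j γ z)
          (fun j _ => tsum_nonneg (hz j)) (Finset.mem_univ i)
      _ ≤ b := hzb
  choose D hD0 hD using fun i => exists_sum_energy_le (hsepi i) (hη i) (hnonneg i) hs hC
    (hdecay i) hb0.le (hfin i) (hφ i) (by positivity : 0 < a / 16)
  have hDs : 0 < D 0 + D 1 := add_pos (hD0 0) (hD0 1)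
  refine ⟨a / (8 * (D 0 + D 1)), max (a / (8 * (D 0 + D 1))) (2 * b ^ 2), by positivity,
    le_max_left _ _, fun f => ?_⟩
  set X : (i : Fin 2) → Γ i → ℝ := fun i γ => ‖locOp (η i γ) (φ i) f‖ ^ 2 with hX
  set E : (i : Fin 2) → Γ i → ℝ := fun i γ => ∫ z, η i γ z * ‖stft (φ i) f z‖ ^ 2 with hEdef
  have hX0 : ∀ i γ, 0 ≤ X i γ := fun i γ => sq_nonneg _
  have hE0 : ∀ i γ, 0 ≤ E i γ := fun i γ => integral_nonneg_of_ae (by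
    filter_upwards [hnonneg i γ] with z hz
    exact mul_nonneg hz (sq_nonneg _))
  have hEle : ∀ i (Λ : Finset (Γ i)), ∑ γ ∈ Λ, E i γ ≤ b * ‖f‖ ^ 2 := fun i Λ =>
    sum_integral_symbol_mul_le (hη i) Λ (hfin i Λ) (hφ i) f
  have hXE : ∀ i γ, X i γ ≤ b * E i γ := fun i γ =>
    norm_locOp_sq_le (hη i γ) (hnonneg i γ) hb0
      (by simpa using hfin i {γ}) (hφ i) f
  have hEs : ∀ i, Summable (E i) := fun i => summable_of_sum_le (hE0 i) (hEle i)
  have hXs : ∀ i, Summable (X i) := fun i =>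
    Summable.of_nonneg_of_le (hX0 i) (hXE i) ((hEs i).mul_left b)
  have hXb : ∀ i, ∑' γ, X i γ ≤ b ^ 2 * ‖f‖ ^ 2 := fun i => by
    calc ∑' γ, X i γ ≤ ∑' γ, b * E i γ := (hXs i).tsum_le_tsum (hXE i) ((hEs i).mul_left b)
      _ = b * ∑' γ, E i γ := tsum_mul_left
      _ ≤ b * (b * ‖f‖ ^ 2) := by
        gcongr
        exact (hEs i).tsum_le_of_sum_le (hEle i)
      _ = b ^ 2 * ‖f‖ ^ 2 := by ring
  have hED : ∀ i, ∑' γ, E i γ ≤ D i * ∑' γ, X i γ + a / 16 * ‖f‖ ^ 2 := fun i =>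
    (hEs i).tsum_le_of_sum_le fun Λ => (hD i f Λ).trans (by
      gcongr
      · exact (hD0 i).le
      · exact (hXs i).sum_le_tsum Λ fun γ _ => hX0 i γ)
  have hlow : a / 4 * ‖f‖ ^ 2 ≤ ∑ i, ∑' γ, E i γ :=
    le_total_energy hη h0 ha (hab.mono fun z hz => ⟨hz.1, hz.2.1⟩) hφ hdist f hEs
  have hT0 : ∀ i, 0 ≤ ∑' γ, X i γ := fun i => tsum_nonneg (hX0 i)
  refine ⟨hXs, ?_, ?_⟩
  · rw [Fin.sum_univ_two] at hlow ⊢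
    have h1 := hED 0
    have h2 := hED 1
    have h3 : a / 8 * ‖f‖ ^ 2 ≤ (D 0 + D 1) * (∑' γ, X 0 γ + ∑' γ, X 1 γ) := by
      nlinarith [mul_nonneg (hD0 0).le (hT0 1), mul_nonneg (hD0 1).le (hT0 0)]
    calc a / (8 * (D 0 + D 1)) * ‖f‖ ^ 2 = (a / 8 * ‖f‖ ^ 2) / (D 0 + D 1) := by
          field_simp
      _ ≤ _ := by rw [div_le_iff₀ hDs]; linarith
  · rw [Fin.sum_univ_two]
    calc ∑' γ, X 0 γ + ∑' γ, X 1 γ ≤ 2 * b ^ 2 * ‖f‖ ^ 2 := by linarith [hXb 0, hXb 1]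
      _ ≤ _ := by gcongr; exact le_max_right _ _
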